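/- Let $\mathcal{X}$ be a compact metric space; for a compact metric space $Y$ let $\mathcal{M}_1^+(Y)$ be the set of Borel probability measures on $Y$ with the weak (vague) topology. For $1\le k\le n$ and $\mu\in\mathcal{M}_1^+(\mathcal{X}^n)$ let $T^n_k\mu\in\mathcal{M}_1^+(\mathcal{X}^k)$ be the law of $(X_{i_1},\dots,X_{i_k})$, where $(X_1,\dots,X_n)$ has law $\mu$ and $1\le i_1<\dots<i_k\le n$ is an independent, uniformly chosen $k$-subset, i.e. $$T^n_k\mu(A)=\binom nk^{-1}\sum_{1\le i_1<\dots<i_k\le n}\mu\{(X_{i_1},\dots,X_{i_k})\in A\}.$$ A triangular array $(\mu_n\in\mathcal{M}_1^+(\mathcal{X}^n):n\ge1)$ is *thinning-invariant* if $\mu_k=T^n_k\mu_n$ for all $1\le k\le n$. Let $\mathcal{K}$ be the set of Borel maps $t\mapsto\mu(\cdot,t)$ from $[0,1]$ to $\mathcal{M}_1^+(\mathcal{X})$, modulo equality Lebesgue-almost everywhere, with the coarsest topology that makes $\mu\mapsto\langle\mu,F\rangle=\int_0^1\int_{\mathcal{X}}F(x,t)\,\mu(dx,t)\,dt$ continuous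 for every $F\in L^1([0,1],C(\mathcal{X}))$. For $\mu\in\mathcal{K}$ and $n\ge1$ put $$\mu^{[n]}(dX_1\otimes\cdots\otimes dX_n)=\int_{\Delta^n}\mu(dX_1,t_1)\cdots\mu(dX_n,t_n)\,n!\,dt_1\cdots dt_n,\qquad \Delta^n=\{0<t_1<\dots<t_n<1\}.$$ **Theorem.** 1. $\mathcal{K}$ is compact and metrizable. 2. For every thinning-invariant array $(\mu_n)$ there is a unique Borel probability measure $P$ on $\mathcal{K}$ such that $\mu_n=\int_{\mathcal{K}}\mu^{[n]}\,P(d\mu)$ for every $n\ge1$. Conversely, for every Borel probability measure $P$ on $\mathcal{K}$ these formulas define a thinning-invariant array. 3. The set of thinning-invariant arrays, viewed as a subset of the locally convex space $\prod_{n\ge1}\mathbb{R}^{C(\mathcal{X}^n)}$ (product topology) through $(\mu_n)\mapsto(f\mapsto\int f\,d\mu_n)_{n\ge1}$, is a Bauer simplex: it is compact and convex, its set of extreme points is closed, and each of its points is the barycenter of exactly one Radon probability measure on the set of extreme points. 4. Its extreme points are exactly the "ordered, conditionally independent" arrays $(\mu^{[n]})_{n\ge1}$ with $\mu\in\mathcal{K}$.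 -/

import Mathlib

open MeasureTheory Set
open scoped ENNReal Nat

noncomputable section

/-- The law `T^n_k μ` of the subsequence `(X_{i_1}, …, X_{i_k})` of `(X_1, …, X_n) ∼ μ`, where
`i_1 < ⋯ < i_k` is a uniformly chosen `k`-subset of the `n` indices. -/
def thin {𝒳 : Type*} [MeasurableSpace 𝒳] (k n : ℕ) (μ : Measure (Fin n → 𝒳)) :
    Measure (Fin k → 𝒳) :=
  (n.choose k : ℝ≥0∞)⁻¹ • ∑ i : Fin k ↪o Fin n, μ.map (fun x j ↦ x (i j))

/-- Triangular arrays: sequences `(μ_n ∈ M_1^+(𝒳^n) : n ≥ 1)`. -/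
abbrev TriangularArray (𝒳 : Type*) [MeasurableSpace 𝒳] : Type _ :=
  (n : ℕ+) → ProbabilityMeasure (Fin n → 𝒳)

/-- Thinning-invariance: `μ_k = T^n_k μ_n` for all `1 ≤ k ≤ n`. -/
def ThinningInvariant {𝒳 : Type*} [MeasurableSpace 𝒳] (m : TriangularArray 𝒳) : Prop :=
  ∀ k n : ℕ+, k ≤ n → (m k : Measure (Fin k → 𝒳)) = thin k n (m n : Measure (Fin n → 𝒳))

/-- The space `𝒦` of Borel maps `t ↦ μ(·, t)` from `[0,1]` to `M_1^+(𝒳)` (with its weak topology),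
modulo equality Lebesgue-almost everywhere. -/
def Profile (𝒳 : Type*) [TopologicalSpace 𝒳] [MeasurableSpace 𝒳] [OpensMeasurableSpace 𝒳] :
    Type _ :=
  unitInterval →ₘ[volume] ProbabilityMeasure 𝒳

namespace Profile

variable {𝒳 : Type*} [TopologicalSpace 𝒳] [MeasurableSpace 𝒳] [OpensMeasurableSpace 𝒳]

/-- The measure `μ(·, t)`, through a measurable representative. -/
def law (κ : Profile 𝒳) (t : unitInterval) : ProbabilityMeasure 𝒳 :=
  AEEqFun.cast κ t

/-- The pairing `⟨μ, F⟩ = ∫₀¹ ∫ F(x, t) μ(dx, t) dt` with `F ∈ L¹([0,1], C(𝒳))`. -/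
def pairing [CompactSpace 𝒳] (κ : Profile 𝒳) (F : unitInterval →₁[volume] C(𝒳, ℝ)) : ℝ :=
  ∫ t, ∫ x, F t x ∂(κ.law t : Measure 𝒳)

/-- The weak topology: the coarsest one making every `⟨·, F⟩` continuous. -/
instance [CompactSpace 𝒳] : TopologicalSpace (Profile 𝒳) :=
  ⨅ F : unitInterval →₁[volume] C(𝒳, ℝ),
    TopologicalSpace.induced (fun κ : Profile 𝒳 ↦ κ.pairing F) inferInstance

instance [CompactSpace 𝒳] : MeasurableSpace (Profile 𝒳) := borel (Profile 𝒳)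

instance [CompactSpace 𝒳] : BorelSpace (Profile 𝒳) := ⟨rfl⟩

end Profile

/-- The open ordered simplex `Δ^n = {0 < t_1 < ⋯ < t_n < 1}`. -/
def orderedSimplex (n : ℕ) : Set (Fin n → unitInterval) :=
  {t | StrictMono t ∧ ∀ i, 0 < t i ∧ t i < 1}

/-- The ordered, conditionally independent law
`∫_{Δ^n} μ(dX_1, t_1) ⋯ μ(dX_n, t_n) n! dt_1 ⋯ dt_n` on `𝒳^n`. -/
def orderedLaw {𝒳 : Type*} [TopologicalSpace 𝒳] [MeasurableSpace 𝒳] [OpensMeasurableSpace 𝒳]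
    (κ : Profile 𝒳) (n : ℕ) : Measure (Fin n → 𝒳) :=
  (n ! : ℝ≥0∞) • (volume.restrict (orderedSimplex n)).bind
    (fun t ↦ Measure.pi (fun i ↦ (κ.law (t i) : Measure 𝒳)))

/-- The mixture `∫_𝒦 (∫_{Δ^n} μ(dX_1, t_1) ⋯ μ(dX_n, t_n) n! dt) P(dμ)`. -/
def orderedMixture {𝒳 : Type*} [TopologicalSpace 𝒳] [CompactSpace 𝒳] [MeasurableSpace 𝒳]
    [OpensMeasurableSpace 𝒳] (P : ProbabilityMeasure (Profile 𝒳)) (n : ℕ) :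
    Measure (Fin n → 𝒳) :=
  (P : Measure (Profile 𝒳)).bind (fun κ ↦ orderedLaw κ n)

/-- The locally convex space in which the arrays live: each `μ_n` is viewed, by Riesz–Markov, as a
functional on `C(𝒳^n)`, and the product topology is that of pointwise convergence, so that it
induces on arrays the product of the weak (vague) topologies. -/
abbrev ArraySpace (𝒳 : Type*) [TopologicalSpace 𝒳] : Type _ :=
  (n : ℕ+) → C(Fin n → 𝒳, ℝ) → ℝ

/-- The (affine, injective) embedding of the arrays into `ArraySpace`. -/
def TriangularArray.toFunctional {𝒳 : Type*} [TopologicalSpace 𝒳] [MeasurableSpace 𝒳]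
    (m : TriangularArray 𝒳) : ArraySpace 𝒳 :=
  fun n f ↦ ∫ x, f x ∂(m n : Measure (Fin n → 𝒳))

/-- The set of thinning-invariant arrays, as a subset of `ArraySpace`. -/
def thinningInvariantSet (𝒳 : Type*) [TopologicalSpace 𝒳] [MeasurableSpace 𝒳] :
    Set (ArraySpace 𝒳) :=
  TriangularArray.toFunctional '' {m : TriangularArray 𝒳 | ThinningInvariant m}

/-- Bauer simplices in a (Hausdorff, locally convex) real topological vector space: compact convex
sets `S` with a closed set of extreme points, such that every point of `S` is the barycenter of
exactly one Radon probability measure on the set of extreme points. -/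
structure IsBauerSimplex {E : Type*} [AddCommGroup E] [Module ℝ E] [TopologicalSpace E]
    (S : Set E) : Prop where
  isCompact : IsCompact S
  convex : Convex ℝ S
  isClosed_extremePoints : IsClosed (S.extremePoints ℝ)
  existsUnique_representing : ∀ x ∈ S,
    letI : MeasurableSpace (S.extremePoints ℝ) := borel _
    ∃! Q : Measure (S.extremePoints ℝ), IsProbabilityMeasure Q ∧ Q.Regular ∧
      ∀ ℓ : E →L[ℝ] ℝ, ∫ e, ℓ (e : E) ∂Q = ℓ x

end

set_option linter.unusedSectionVars false

open Topology ProbabilityTheory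
open scoped unitInterval

noncomputable section

/-! Everything is transported to probability measures on the space `Profile 𝒳`. A profile is encoded
by its Young measure, the joint law of a uniform time `T` and a point drawn from `μ(·, T)`. By
disintegration these are exactly the probability measures on `I × 𝒳` with uniform first marginal: a
closed subset of a compact metrizable space, and the weak topology on profiles is the induced one
(`Profile.isClosedEmbedding_young`).

The averages `κ ↦ ∫ f dκ^{[n]}` are continuous (`Profile.continuous_moment`) and form an algebra:
two independent ordered samples, merged, are governed by the relative order of all their times,
hence by one longer ordered law. They separate profiles because time moments are among them: the
chance that `a` further uniform times all precede `s` is `s ^ a`. By Stone–Weierstrass they are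
dense in `C(Profile 𝒳, ℝ)`, so a mixing measure is unique.

For existence, run through the points of a sample from `μ_n` at constant speed (`stepProfile`). The
`k`-th ordered law of this profile is the law of a uniform `k`-subsequence, up to the probability
that two of `k` uniform times share one of the `n` cells
(`abs_integral_orderedLaw_stepProfile_sub_le`). By invariance the subsequence has mean law `μ_k`, so
any limit point of the laws of the step profiles is a mixing measure.

Thus mixing is a continuous affine bijection from probability measures on profiles to invariant
arrays. Extreme points correspond to Dirac masses, that is to single profiles, and uniqueness of the
representing measure is uniqueness of the mixing measure. -/

lemma ContinuousMap.integrable_of_compactSpace {Y : Type*} [TopologicalSpace Y] [CompactSpace Y]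
    [MeasurableSpace Y] [OpensMeasurableSpace Y] (f : C(Y, ℝ)) (μ : Measure Y) [IsFiniteMeasure μ] :
    Integrable f μ :=
  (BoundedContinuousFunction.mkOfCompact f).integrable μ

lemma ContinuousMap.lipschitzWith_integral {Y : Type*} [TopologicalSpace Y] [CompactSpace Y]
    [MeasurableSpace Y] [OpensMeasurableSpace Y] (μ : Measure Y) [IsProbabilityMeasure μ] :
    LipschitzWith 1 fun f : C(Y, ℝ) ↦ ∫ x, f x ∂μ := by
  refine LipschitzWith.of_dist_le_mul fun f f' ↦ ?_
  rw [Real.dist_eq, ← integral_sub (f.integrable_of_compactSpace μ) (f'.integrable_of_compactSpace μ),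
    NNReal.coe_one, one_mul]
  have := norm_integral_le_of_norm_le_const (μ := μ) (f := fun x ↦ f x - f' x) (C := dist f f')
    (Filter.Eventually.of_forall fun x ↦ by
      rw [← dist_eq_norm]
      exact ContinuousMap.dist_apply_le_dist x)
  simpa using this

lemma MeasureTheory.Measure.ext_of_forall_integral_continuousMap_eq {Y : Type*} [TopologicalSpace Y]
    [HasOuterApproxClosed Y] [MeasurableSpace Y] [BorelSpace Y] {μ ν : Measure Y}
    [IsFiniteMeasure μ] [IsFiniteMeasure ν] (h : ∀ f : C(Y, ℝ), ∫ x, f x ∂μ = ∫ x, f x ∂ν) : μ = ν :=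
  ext_of_forall_integral_eq_of_IsFiniteMeasure fun f ↦ h f.toContinuousMap

/-! ### Borel structure of the weak topology on probability measures. -/

namespace MeasureTheory.ProbabilityMeasure

/-- Evaluations on closed sets are limits of integrals of continuous functions. -/
lemma measurable_apply_of_isClosed {Y : Type*} [TopologicalSpace Y] [HasOuterApproxClosed Y]
    [MeasurableSpace Y] [OpensMeasurableSpace Y] {F : Set Y} (hF : IsClosed F) :
    Measurable[borel (ProbabilityMeasure Y)] fun ν : ProbabilityMeasure Y ↦ (ν : Measure Y) F := by
  let : MeasurableSpace (ProbabilityMeasure Y) := borel _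
  have : BorelSpace (ProbabilityMeasure Y) := ⟨rfl⟩
  refine measurable_of_tendsto_metrizable (f := fun n (ν : ProbabilityMeasure Y) ↦
    ∫⁻ x, (hF.apprSeq n x : ℝ≥0∞) ∂(ν : Measure Y)) (fun n ↦ ?_) ?_
  · exact (continuous_lintegral_boundedContinuousFunction _).measurable
  · rw [tendsto_pi_nhds]
    exact fun ν ↦ HasOuterApproxClosed.tendsto_lintegral_apprSeq hF _

/-- The evaluations on closed sets suffice, since closed sets are a π-system generating the Borel
sets of `Y`. -/
lemma measurableSpace_le_borel {Y : Type*} [TopologicalSpace Y] [HasOuterApproxClosed Y]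
    [MeasurableSpace Y] [BorelSpace Y] :
    (inferInstance : MeasurableSpace (ProbabilityMeasure Y)) ≤ borel (ProbabilityMeasure Y) := by
  have : Measurable[borel (ProbabilityMeasure Y)] fun ν : ProbabilityMeasure Y ↦ (ν : Measure Y) := by
    let : MeasurableSpace (ProbabilityMeasure Y) := borel _
    exact Measurable.measure_of_isPiSystem_of_isProbabilityMeasure
      (borel_eq_generateFrom_isClosed (α := Y) ▸ BorelSpace.measurable_eq) isPiSystem_isClosed
      fun F hF ↦ measurable_apply_of_isClosed hF
  exact this.comap_le

variable {Y : Type*} [MetricSpace Y] [CompactSpace Y] [MeasurableSpace Y] [BorelSpace Y]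

lemma measurable_integral_continuousMap (f : C(Y, ℝ)) :
    Measurable fun ν : ProbabilityMeasure Y ↦ ∫ x, f x ∂(ν : Measure Y) := by
  have : ∀ ν : ProbabilityMeasure Y, ∫ x, f x ∂(ν : Measure Y) =
      (∫⁻ x, ENNReal.ofReal (f x) ∂(ν : Measure Y)).toReal -
        (∫⁻ x, ENNReal.ofReal (-f x) ∂(ν : Measure Y)).toReal := fun ν ↦
    integral_eq_lintegral_pos_part_sub_lintegral_neg_part (f.integrable_of_compactSpace _)
  simp_rw [this]
  refine Measurable.sub (Measurable.ennreal_toReal ?_) (Measurable.ennreal_toReal ?_)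
  · exact (Measure.measurable_lintegral (by fun_prop)).comp measurable_subtype_coe
  · exact (Measure.measurable_lintegral (by fun_prop)).comp measurable_subtype_coe

/-- Integration against a dense sequence of continuous functions embeds the compact space of
probability measures into `ℕ → ℝ` with measurable coordinates, so open sets are measurable. This
lets a profile be read both as a strongly measurable map and as a kernel. -/
instance borelSpace_of_compactSpace : BorelSpace (ProbabilityMeasure Y) := by
  refine ⟨le_antisymm measurableSpace_le_borel ?_⟩
  let g : ProbabilityMeasure Y → ℕ → ℝ :=
    fun ν n ↦ ∫ x, TopologicalSpace.denseSeq C(Y, ℝ) n x ∂(ν : Measure Y)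
  have hg : Continuous g := _root_.continuous_pi fun n ↦ continuous_integral_continuousMap _
  have hinj : Function.Injective g := by
    intro ν ν' h
    have key : (fun f : C(Y, ℝ) ↦ ∫ x, f x ∂(ν : Measure Y)) = fun f ↦ ∫ x, f x ∂(ν' : Measure Y) :=
      (ContinuousMap.lipschitzWith_integral _).continuous.ext_on
        (TopologicalSpace.denseRange_denseSeq _)
        (ContinuousMap.lipschitzWith_integral _).continuous (by
        rintro _ ⟨n, rfl⟩
        exact congrFun h n)
    exact Subtype.ext (Measure.ext_of_forall_integral_continuousMap_eq
      (μ := (ν : Measure Y)) (ν := (ν' : Measure Y)) (congrFun key))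
  have hemb := (hg.isClosedEmbedding hinj).isInducing
  rw [hemb.eq_induced, borel_comap, ← BorelSpace.measurable_eq (α := ℕ → ℝ)]
  exact (measurable_pi_lambda _ fun n ↦ measurable_integral_continuousMap _).comap_le

/-- Integration is jointly continuous in the function and the measure. -/
lemma continuous_integral_uncurry : Continuous fun p : C(Y, ℝ) × ProbabilityMeasure Y ↦
    ∫ x, p.1 x ∂(p.2 : Measure Y) := by
  refine continuous_prod_of_continuous_lipschitzWith _ 1 ?_ ?_
  · exact fun f ↦ continuous_integral_continuousMap f
  · exact fun ν ↦ ContinuousMap.lipschitzWith_integral (ν : Measure Y)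

end MeasureTheory.ProbabilityMeasure

/-! ### Young measures: compactness and metrizability of the space of profiles. -/

namespace Profile

variable {𝒳 : Type*} [MetricSpace 𝒳] [CompactSpace 𝒳] [MeasurableSpace 𝒳] [BorelSpace 𝒳]

lemma stronglyMeasurable_law (κ : Profile 𝒳) : StronglyMeasurable κ.law :=
  AEEqFun.stronglyMeasurable κ

@[fun_prop]
lemma measurable_law (κ : Profile 𝒳) : Measurable κ.law := κ.stronglyMeasurable_law.measurable

lemma ext_law {κ κ' : Profile 𝒳} (h : κ.law =ᵐ[volume] κ'.law) : κ = κ' := AEEqFun.ext h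

/-- The profile as a Markov kernel. -/
def kernel (κ : Profile 𝒳) : Kernel I 𝒳 :=
  ⟨fun t ↦ κ.law t, measurable_subtype_coe.comp κ.measurable_law⟩

@[simp]
lemma kernel_apply (κ : Profile 𝒳) (t : I) : κ.kernel t = κ.law t := rfl

instance (κ : Profile 𝒳) : IsMarkovKernel κ.kernel :=
  ⟨fun t ↦ inferInstanceAs (IsProbabilityMeasure (κ.law t : Measure 𝒳))⟩

/-- The profile with a given measurable representative. -/
def ofMeasurable (η : I → ProbabilityMeasure 𝒳) (hη : Measurable η) : Profile 𝒳 :=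
  AEEqFun.mk η hη.stronglyMeasurable.aestronglyMeasurable

lemma law_ofMeasurable (η : I → ProbabilityMeasure 𝒳) (hη : Measurable η) :
    (ofMeasurable η hη).law =ᵐ[volume] η :=
  AEEqFun.coeFn_mk _ _

/-- The joint law on `[0,1] × 𝒳` of a uniform `T` and of `X ∼ μ(·, T)`. -/
def young (κ : Profile 𝒳) : ProbabilityMeasure (I × 𝒳) :=
  ⟨(volume : Measure I) ⊗ₘ κ.kernel, inferInstance⟩

lemma integral_young (κ : Profile 𝒳) (f : C(I × 𝒳, ℝ)) :
    ∫ z, f z ∂(κ.young : Measure (I × 𝒳)) = ∫ t, ∫ x, f (t, x) ∂(κ.law t : Measure 𝒳) :=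
  Measure.integral_compProd (f.integrable_of_compactSpace _)

lemma young_injective : Function.Injective (young (𝒳 := 𝒳)) := by
  intro κ κ' h
  have h' : (volume : Measure I) ⊗ₘ κ.kernel = volume ⊗ₘ κ'.kernel := congrArg Subtype.val h
  refine ext_law ?_
  filter_upwards [Kernel.ae_eq_of_compProd_eq h'] with t ht
  exact Subtype.ext ht

/-- Disintegration along the first coordinate recovers a profile from a measure with uniform
marginal. -/
lemma range_young : range (young (𝒳 := 𝒳)) = 
    {ν : ProbabilityMeasure (I × 𝒳) | (ν : Measure (I × 𝒳)).fst = volume} := by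
  ext ν
  constructor
  · rintro ⟨κ, rfl⟩
    exact Measure.fst_compProd _ _
  · intro hν
    replace hν : (ν : Measure (I × 𝒳)).fst = volume := hν
    have : Nonempty 𝒳 := (ProbabilityMeasure.nonempty ν).map Prod.snd
    let η : I → ProbabilityMeasure 𝒳 := fun t ↦ ⟨(ν : Measure (I × 𝒳)).condKernel t, inferInstance⟩
    have hη : Measurable η := (Kernel.measurable _).subtype_mk
    refine ⟨ofMeasurable η hη, Subtype.ext ?_⟩
    change _ = (ν : Measure (I × 𝒳))
    rw [← (ν : Measure (I × 𝒳)).disintegrate (ν : Measure (I × 𝒳)).condKernel, hν]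
    refine Measure.compProd_congr ?_
    filter_upwards [law_ofMeasurable η hη] with t ht
    rw [kernel_apply, ht]
    rfl

lemma isClosed_range_young : IsClosed (range (young (𝒳 := 𝒳))) := by
  rw [range_young]
  let F : ProbabilityMeasure (I × 𝒳) → ProbabilityMeasure I :=
    fun ν ↦ ν.map (f := Prod.fst) (by fun_prop)
  have hF : Continuous F := ProbabilityMeasure.continuous_map continuous_fst
  let v : ProbabilityMeasure I := ⟨volume, inferInstance⟩
  convert (isClosed_singleton (x := v)).preimage hF using 1
  ext ν
  exact ⟨fun h ↦ Subtype.ext h, fun h ↦ congrArg Subtype.val h⟩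

/-- The element of `L¹([0,1], C(𝒳))` attached to a continuous function. -/
def curryLp (f : C(I × 𝒳, ℝ)) : I →₁[volume] C(𝒳, ℝ) := ContinuousMap.toLp 1 volume ℝ f.curry

lemma pairing_curryLp (κ : Profile 𝒳) (f : C(I × 𝒳, ℝ)) :
    κ.pairing (curryLp f) = ∫ z, f z ∂(κ.young : Measure (I × 𝒳)) := by
  rw [integral_young]
  refine integral_congr_ae ?_
  filter_upwards [ContinuousMap.coeFn_toLp (p := 1) (𝕜 := ℝ) volume f.curry] with t ht
  rw [curryLp, ht]
  rfl

lemma integrable_pairing (κ : Profile 𝒳) (F : I →₁[volume] C(𝒳, ℝ)) :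
    Integrable (fun t ↦ ∫ x, F t x ∂(κ.law t : Measure 𝒳)) := by
  refine (L1.integrable_coeFn F).norm.mono' ?_ (Filter.Eventually.of_forall fun t ↦ ?_)
  · exact ProbabilityMeasure.continuous_integral_uncurry.comp_aestronglyMeasurable
      ((L1.integrable_coeFn F).aestronglyMeasurable.prodMk
        κ.stronglyMeasurable_law.aestronglyMeasurable)
  · simpa using norm_integral_le_of_norm_le_const (μ := (κ.law t : Measure 𝒳)) (f := F t) (C := ‖F t‖)
      (Filter.Eventually.of_forall fun x ↦ (F t).norm_coe_le_norm x)

lemma lipschitzWith_pairing (κ : Profile 𝒳) : LipschitzWith 1 κ.pairing := by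
  refine LipschitzWith.of_dist_le_mul fun F G ↦ ?_
  rw [NNReal.coe_one, one_mul, L1.dist_eq_integral_dist, dist_eq_norm, pairing, pairing,
    ← integral_sub (κ.integrable_pairing F) (κ.integrable_pairing G)]
  refine norm_integral_le_of_norm_le (g := fun t ↦ dist (F t) (G t)) ?_ (Filter.Eventually.of_forall fun t ↦ ?_)
  · simp_rw [dist_eq_norm]
    exact ((L1.integrable_coeFn F).sub (L1.integrable_coeFn G)).norm
  · rw [← dist_eq_norm]
    simpa using (ContinuousMap.lipschitzWith_integral (κ.law t : Measure 𝒳)).dist_le_mul (F t) (G t)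

lemma continuous_young : Continuous (young (𝒳 := 𝒳)) := by
  rw [ProbabilityMeasure.continuous_iff_forall_continuousMap_continuous_integral]
  intro f
  simp_rw [← pairing_curryLp]
  exact continuous_iInf_dom (i := curryLp f) continuous_induced_dom

lemma denseRange_curryLp : DenseRange (curryLp (𝒳 := 𝒳)) := by
  have := ContinuousMap.toLp_denseRange C(𝒳, ℝ) (volume : Measure I) ℝ (p := 1) (by simp)
  refine this.comp (f := fun f : C(I × 𝒳, ℝ) ↦ f.curry) ?_ (map_continuous _)
  exact Function.Surjective.denseRange fun g ↦ ⟨g.uncurry, by ext; rfl⟩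

/-- Testing against all of `L¹(I, C(𝒳))` gives no finer topology than testing against `C(I × 𝒳)`:
the latter is dense in the former, and the pairing is 1-Lipschitz in `F` uniformly in the profile,
so every pairing is a uniform limit of integrals against Young measures. -/
lemma isInducing_young : IsInducing (young (𝒳 := 𝒳)) := by
  refine ⟨le_antisymm continuous_young.le_induced (le_iInf fun F ↦ ?_)⟩
  rw [← continuous_iff_le_induced]
  let := TopologicalSpace.induced (young (𝒳 := 𝒳)) inferInstance
  refine continuous_of_uniform_approx_of_continuous fun u hu ↦ ?_
  obtain ⟨ε, hε, hεu⟩ := Metric.mem_uniformity_dist.1 hu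
  obtain ⟨f, hf⟩ := denseRange_curryLp.exists_dist_lt F hε
  refine ⟨fun κ ↦ ∫ z, f z ∂(κ.young : Measure (I × 𝒳)), ?_, fun κ ↦ hεu ?_⟩
  · exact (ProbabilityMeasure.continuous_integral_continuousMap f).comp continuous_induced_dom
  · simp only [← pairing_curryLp]
    refine lt_of_le_of_lt ?_ hf
    simpa using κ.lipschitzWith_pairing.dist_le_mul F (curryLp f)

lemma isClosedEmbedding_young : IsClosedEmbedding (young (𝒳 := 𝒳)) :=
  ⟨⟨isInducing_young, young_injective⟩, isClosed_range_young⟩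

instance : CompactSpace (Profile 𝒳) := isClosedEmbedding_young.compactSpace

instance : TopologicalSpace.MetrizableSpace (Profile 𝒳) :=
  isClosedEmbedding_young.isEmbedding.metrizableSpace

end Profile

/-- The bind is the second marginal of the composition-product, where Fubini is available. -/
lemma MeasureTheory.Measure.integral_bind_kernel {α Y : Type*} [MeasurableSpace α]
    [MeasurableSpace Y] (μ : Measure α) [SFinite μ] (η : Kernel α Y) [IsSFiniteKernel η] {f : Y → ℝ}
    (hf : Integrable f (μ.bind η)) :
    ∫ y, f y ∂(μ.bind η) = ∫ a, ∫ y, f y ∂(η a) ∂μ := by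
  rw [← Measure.snd_compProd] at hf ⊢
  rw [Measure.snd, integral_map measurable_snd.aemeasurable hf.aestronglyMeasurable]
  exact Measure.integral_compProd (hf.comp_measurable measurable_snd)

/-! ### Moments of profiles and their continuity. -/

namespace Profile

variable {𝒳 : Type*} [MetricSpace 𝒳] [CompactSpace 𝒳] [MeasurableSpace 𝒳] [BorelSpace 𝒳]
  {ι : Type*} [Fintype ι]

/-- The kernel `(t_i) ↦ ⨂ μ(·, t_i)`. -/
def piKernel (κ : Profile 𝒳) (ι : Type*) [Fintype ι] : Kernel (ι → I) (ι → 𝒳) where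
  toFun t := Measure.pi fun i ↦ (κ.law (t i) : Measure 𝒳)
  measurable' := by
    refine Measurable.measure_of_isPiSystem_of_isProbabilityMeasure generateFrom_pi.symm
      isPiSystem_pi ?_
    rintro _ ⟨s, hs, rfl⟩
    simp_rw [Measure.pi_pi]
    refine Finset.measurable_fun_prod _ fun i _ ↦ ?_
    exact (κ.kernel.measurable_coe (hs i (mem_univ i))).comp (measurable_pi_apply i)

lemma piKernel_apply (κ : Profile 𝒳) (t : ι → I) :
    κ.piKernel ι t = Measure.pi fun i ↦ (κ.law (t i) : Measure 𝒳) := rfl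

instance (κ : Profile 𝒳) : IsMarkovKernel (κ.piKernel ι) :=
  ⟨fun t ↦ by rw [piKernel_apply]; infer_instance⟩

/-- For independent pairs `(T_i, X_i)` with law `κ.young`, the times are independent and uniform,
and given the times the `X_i` are independent with laws `κ.law (T_i)`. It is enough to test on
products of functions of single coordinates. -/
lemma map_pi_young (κ : Profile 𝒳) :
    (Measure.pi fun _ : ι ↦ (κ.young : Measure (I × 𝒳))).map
      (fun z ↦ (fun i ↦ (z i).1, fun i ↦ (z i).2)) = volume ⊗ₘ κ.piKernel ι := by
  have : IsFiniteMeasure ((Measure.pi fun _ : ι ↦ (κ.young : Measure (I × 𝒳))).map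
      (fun z ↦ (fun i ↦ (z i).1, fun i ↦ (z i).2) : (ι → I × 𝒳) → (ι → I) × (ι → 𝒳))) := by
    infer_instance
  refine Measure.ext_of_integral_prod_mul_prod_boundedContinuousFunction fun f g ↦ ?_
  have h1 : Continuous fun p : (ι → I) × (ι → 𝒳) ↦ (∏ i, f i (p.1 i)) * ∏ i, g i (p.2 i) := by
    fun_prop
  have hm : AEMeasurable (fun z ↦ ((fun i ↦ (z i).1, fun i ↦ (z i).2) : (ι → I) × (ι → 𝒳)))
      (Measure.pi fun _ : ι ↦ (κ.young : Measure (I × 𝒳))) := by fun_prop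
  have h3 : Integrable (fun p : (ι → I) × (ι → 𝒳) ↦ (∏ i, f i (p.1 i)) * ∏ i, g i (p.2 i))
    (volume ⊗ₘ κ.piKernel ι) := ContinuousMap.integrable_of_compactSpace ⟨_, h1⟩ _
  rw [integral_map hm h1.aestronglyMeasurable, Measure.integral_compProd h3]
  simp_rw [integral_const_mul, piKernel_apply, integral_fintype_prod_eq_prod,
    ← Finset.prod_mul_distrib]
  rw [integral_fintype_prod_eq_prod (fun i (z : I × 𝒳) ↦ f i z.1 * g i z.2), volume_pi,
    integral_fintype_prod_eq_prod (fun i t ↦ f i t * ∫ x, g i x ∂(κ.law t : Measure 𝒳))]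
  refine Finset.prod_congr rfl fun i _ ↦ ?_
  have h2 : Continuous fun z : I × 𝒳 ↦ f i z.1 * g i z.2 := by fun_prop
  refine (κ.integral_young ⟨_, h2⟩).trans ?_
  simp only [ContinuousMap.coe_mk, integral_const_mul]

/-- The functional `κ ↦ ∫ h(t) (⨂ κ_{t_i})(f) dt`. -/
def moment (κ : Profile 𝒳) (h : (ι → I) → ℝ) (f : C(ι → 𝒳, ℝ)) : ℝ :=
  ∫ t, h t * ∫ x, f x ∂(κ.piKernel ι t)

lemma stronglyMeasurable_integral_piKernel (κ : Profile 𝒳) (f : C(ι → 𝒳, ℝ)) :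
    StronglyMeasurable fun t ↦ ∫ x, f x ∂(κ.piKernel ι t) := by
  have := (f.continuous.stronglyMeasurable.comp_measurable
      (measurable_snd : Measurable (Prod.snd : (ι → I) × (ι → 𝒳) → _))).integral_kernel_prod_right'
        (κ := κ.piKernel ι)
  exact this

lemma abs_integral_piKernel_le (κ : Profile 𝒳) (f : C(ι → 𝒳, ℝ)) (t : ι → I) :
    |∫ x, f x ∂(κ.piKernel ι t)| ≤ ‖f‖ := by
  simpa using norm_integral_le_of_norm_le_const (μ := κ.piKernel ι t) (f := f) (C := ‖f‖)
      (Filter.Eventually.of_forall fun x ↦ f.norm_coe_le_norm x)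

lemma integrable_moment (κ : Profile 𝒳) {h : (ι → I) → ℝ} (hh : Integrable h) (f : C(ι → 𝒳, ℝ)) :
    Integrable fun t ↦ h t * ∫ x, f x ∂(κ.piKernel ι t) :=
  hh.mul_bdd (c := ‖f‖) (κ.stronglyMeasurable_integral_piKernel f).aestronglyMeasurable
    (Filter.Eventually.of_forall (κ.abs_integral_piKernel_le f))

lemma moment_eq_integral_young (κ : Profile 𝒳) (h : C(ι → I, ℝ)) (f : C(ι → 𝒳, ℝ)) :
    κ.moment h f = ∫ z, h (fun i ↦ (z i).1) * f (fun i ↦ (z i).2)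
      ∂(ProbabilityMeasure.pi fun _ : ι ↦ κ.young : Measure (ι → I × 𝒳)) := by
  have h1 : Continuous fun p : (ι → I) × (ι → 𝒳) ↦ h p.1 * f p.2 := by fun_prop
  have hm : AEMeasurable (fun z ↦ ((fun i ↦ (z i).1, fun i ↦ (z i).2) : (ι → I) × (ι → 𝒳)))
      (Measure.pi fun _ : ι ↦ (κ.young : Measure (I × 𝒳))) := by fun_prop
  have := integral_map hm (f := fun p ↦ h p.1 * f p.2) h1.aestronglyMeasurable
  rw [ProbabilityMeasure.toMeasure_pi, ← this, map_pi_young, Measure.integral_compProd]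
  · simp only [moment, integral_const_mul]
  · exact ContinuousMap.integrable_of_compactSpace ⟨_, h1⟩ _

lemma abs_moment_sub_le (κ : Profile 𝒳) {h h' : (ι → I) → ℝ} (hh : Integrable h)
    (hh' : Integrable h') (f : C(ι → 𝒳, ℝ)) :
    |κ.moment h f - κ.moment h' f| ≤ (∫ t, ‖h t - h' t‖) * ‖f‖ := by
  rw [moment, moment, ← integral_sub (κ.integrable_moment hh f) (κ.integrable_moment hh' f),
    ← integral_mul_const, ← Real.norm_eq_abs]
  refine norm_integral_le_of_norm_le ((hh.sub hh').norm.mul_const _)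
    (Filter.Eventually.of_forall fun t ↦ ?_)
  rw [← sub_mul, norm_mul]
  gcongr
  exact κ.abs_integral_piKernel_le f t

/-- For continuous `h` the moment integrates a fixed continuous function against a power of the
Young measure. A merely integrable `h`, such as the indicator of the ordered simplex, is an `L¹`
limit of continuous ones, and the error is uniform in `κ`. -/
lemma continuous_moment {h : (ι → I) → ℝ} (hh : Integrable h) (f : C(ι → 𝒳, ℝ)) :
    Continuous fun κ : Profile 𝒳 ↦ κ.moment h f := by
  refine continuous_of_uniform_approx_of_continuous fun u hu ↦ ?_
  obtain ⟨ε, hε, hεu⟩ := Metric.mem_uniformity_dist.1 hu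
  have hf : 0 < ‖f‖ + 1 := by positivity
  obtain ⟨g, hg, hgint⟩ := hh.exists_boundedContinuous_integral_sub_le (div_pos (half_pos hε) hf)
  refine ⟨fun κ ↦ κ.moment g f, ?_, fun κ ↦ hεu ?_⟩
  · have : ∀ κ : Profile 𝒳, κ.moment g f = _ := fun κ ↦ κ.moment_eq_integral_young g.toContinuousMap f
    simp_rw [this]
    refine (ProbabilityMeasure.continuous_integral_continuousMap
      (⟨fun z : ι → I × 𝒳 ↦ g (fun i ↦ (z i).1) * f (fun i ↦ (z i).2), by fun_prop⟩ :
        C(ι → I × 𝒳, ℝ))).comp ?_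
    exact ProbabilityMeasure.continuous_pi.comp (continuous_pi fun _ ↦ continuous_young)
  · rw [Real.dist_eq]
    calc _ ≤ (∫ t, ‖h t - g t‖) * ‖f‖ := κ.abs_moment_sub_le hh hgint f
      _ ≤ ε / 2 / (‖f‖ + 1) * (‖f‖ + 1) := by gcongr; linarith
      _ < ε := by rw [div_mul_cancel₀ _ hf.ne']; linarith

end Profile

/-! ### The ordered simplex and integrals against ordered laws. -/

lemma measurableSet_orderedSimplex (n : ℕ) : MeasurableSet (orderedSimplex n) := by
  have : orderedSimplex n = (⋂ i, ⋂ j, ⋂ _ : i < j, {t | t i < t j}) ∩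
      ⋂ i, ({t | 0 < t i} ∩ {t | t i < 1}) := by
    ext t
    simp only [orderedSimplex, StrictMono, mem_ofPred_eq, mem_inter_iff, mem_iInter]
  rw [this]
  refine MeasurableSet.inter ?_ ?_
  · refine MeasurableSet.iInter fun i ↦ MeasurableSet.iInter fun j ↦ MeasurableSet.iInter fun _ ↦ ?_
    exact measurableSet_lt (by fun_prop) (by fun_prop)
  · refine MeasurableSet.iInter fun i ↦ MeasurableSet.inter ?_ ?_
    · exact measurableSet_lt (by fun_prop) (by fun_prop)
    · exact measurableSet_lt (by fun_prop) (by fun_prop)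

lemma integrable_indicator_orderedSimplex (n : ℕ) :
    Integrable ((orderedSimplex n).indicator (1 : (Fin n → I) → ℝ)) :=
  (integrable_const (1 : ℝ)).indicator (measurableSet_orderedSimplex n)

variable {𝒳 : Type*} [MetricSpace 𝒳] [CompactSpace 𝒳] [MeasurableSpace 𝒳] [BorelSpace 𝒳]

lemma orderedLaw_eq (κ : Profile 𝒳) (n : ℕ) : orderedLaw κ n =
    (n ! : ℝ≥0∞) • (volume.restrict (orderedSimplex n)).bind (κ.piKernel (Fin n)) := rfl

lemma integral_orderedLaw (κ : Profile 𝒳) (n : ℕ) (f : C(Fin n → 𝒳, ℝ)) :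
    ∫ x, f x ∂(orderedLaw κ n) =
      n ! * ∫ t in orderedSimplex n, ∫ x, f x ∂(κ.piKernel (Fin n) t) := by
  rw [orderedLaw_eq, integral_smul_measure, Measure.integral_bind_kernel]
  · simp
  · exact f.integrable_of_compactSpace _

lemma integral_orderedLaw_eq_moment (κ : Profile 𝒳) (n : ℕ) (f : C(Fin n → 𝒳, ℝ)) :
    ∫ x, f x ∂(orderedLaw κ n) =
      n ! * κ.moment ((orderedSimplex n).indicator 1) f := by
  rw [integral_orderedLaw, Profile.moment, ← integral_indicator (measurableSet_orderedSimplex n)]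
  congr 2 with t
  by_cases ht : t ∈ orderedSimplex n <;> simp [ht]

lemma continuous_integral_orderedLaw (n : ℕ) (f : C(Fin n → 𝒳, ℝ)) :
    Continuous fun κ : Profile 𝒳 ↦ ∫ x, f x ∂(orderedLaw κ n) := by
  simp_rw [integral_orderedLaw_eq_moment]
  exact (Profile.continuous_moment (integrable_indicator_orderedSimplex n) f).const_mul _

/-! ### Independent coordinates and the chambers of the cube. -/

namespace MeasureTheory

/-- Restricting independent coordinates along an injection. -/
lemma measurePreserving_comp_injective {ι ι' Y : Type*} [Fintype ι] [Fintype ι'] [MeasurableSpace Y]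
    (μ : ι' → Measure Y) [∀ i, IsProbabilityMeasure (μ i)] {g : ι → ι'} (hg : Function.Injective g) :
    MeasurePreserving (fun x : ι' → Y ↦ x ∘ g) (Measure.pi μ) (Measure.pi fun i ↦ μ (g i)) := by
  refine ⟨by fun_prop, ?_⟩
  -- The coordinates are independent, and so is any injectively indexed subfamily; its law is
  -- therefore the product of its marginals.
  have h := (iIndepFun_pi (μ := μ) (X := fun _ y ↦ y) fun i ↦ by fun_prop).precomp hg
  rw [iIndepFun_iff_map_fun_eq_pi_map fun i ↦ (measurable_pi_apply (g i)).aemeasurable] at h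
  refine h.trans ?_
  congr with i : 1
  exact (measurePreserving_eval μ (g i)).map_eq

lemma ae_injective_pi {ι : Type*} [Fintype ι] :
    ∀ᵐ t : ι → I, Function.Injective t := by
  have key : ∀ i j : ι, i ≠ j → ∀ᵐ t : ι → I, t i ≠ t j := by
    intro i j hij
    have hg : Function.Injective ![i, j] := by
      intro a b
      fin_cases a <;> fin_cases b <;> simp [hij, hij.symm]
    have h2 : ∀ᵐ s : Fin 2 → I, s 0 ≠ s 1 := by
      have := (volume_preserving_finTwoArrow I)
      refine this.quasiMeasurePreserving.ae (p := fun p ↦ p.1 ≠ p.2) ?_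
      refine (Measure.ae_prod_iff_ae_ae ?_).2 (Filter.Eventually.of_forall fun x ↦ ?_)
      · exact (measurableSet_eq_fun measurable_fst measurable_snd).compl
      · simp [ae_iff]
    exact (measurePreserving_comp_injective (fun _ : ι ↦ (volume : Measure I)) hg
      ).quasiMeasurePreserving.ae h2
  have := ae_all_iff.2 fun i ↦ ae_all_iff.2 fun j ↦ Filter.eventually_imp_distrib_left.2 (key i j)
  filter_upwards [this] with t ht i j hij
  by_contra h
  exact ht i j h hij

lemma ae_mem_Ioo_pi {ι : Type*} [Fintype ι] : ∀ᵐ t : ι → I, ∀ i, 0 < t i ∧ t i < 1 := by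
  refine ae_all_iff.2 fun i ↦ ?_
  have : ∀ᵐ s : I, 0 < s ∧ s < 1 := by
    filter_upwards [Measure.ae_ne volume (0 : I), Measure.ae_ne volume (1 : I)] with s h0 h1
    exact ⟨unitInterval.pos_iff_ne_zero.2 h0, unitInterval.lt_one_iff_ne_one.2 h1⟩
  exact (measurePreserving_eval (fun _ : ι ↦ (volume : Measure I)) i).quasiMeasurePreserving.ae this

end MeasureTheory

section Decomposition

variable {ι : Type*} [Fintype ι] [DecidableEq ι] {N : ℕ}

lemma exists_equiv_comp_mem_orderedSimplex (hN : Fintype.card ι = N) {t : ι → I}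
    (ht : Function.Injective t) (ht' : ∀ i, 0 < t i ∧ t i < 1) :
    ∃ e : ι ≃ Fin N, t ∘ e.symm ∈ orderedSimplex N := by
  let e₀ : ι ≃ Fin N := Fintype.equivFinOfCardEq hN
  refine ⟨e₀.trans (Tuple.sort (t ∘ e₀.symm)).symm, ?_, fun i ↦ ht' _⟩
  exact (Tuple.monotone_sort (t ∘ e₀.symm)).strictMono_of_injective
    (ht.comp ((Tuple.sort (t ∘ e₀.symm)).trans e₀.symm).injective)

/-- Two increasing enumerations of the same finite set coincide, which makes the chambers disjoint.
-/
lemma equiv_eq_of_comp_mem_orderedSimplex {t : ι → I} {e e' : ι ≃ Fin N}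
    (h : t ∘ e.symm ∈ orderedSimplex N) (h' : t ∘ e'.symm ∈ orderedSimplex N) : e = e' := by
  have hr := (StrictMono.range_inj h.1 h'.1).1 (by
    rw [e.symm.surjective.range_comp, e'.symm.surjective.range_comp])
  have hs : e.symm = e'.symm := Equiv.ext fun i ↦ by
    have h1 := h.1.injective
    have ht : Function.Injective t := by
      simpa [Function.comp_assoc] using h1.comp e.injective
    exact ht (congrFun hr i)
  simpa using congrArg Equiv.symm hs

lemma measurePreserving_comp_equiv (e : ι ≃ Fin N) :
    MeasurePreserving (fun s : Fin N → I ↦ s ∘ e) :=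
  measurePreserving_comp_injective (fun _ : Fin N ↦ (volume : Measure I)) e.injective

lemma measurableEmbedding_comp_equiv (e : ι ≃ Fin N) :
    MeasurableEmbedding (fun s : Fin N → I ↦ s ∘ e) :=
  (MeasurableEquiv.arrowCongr' e.symm (MeasurableEquiv.refl I)).measurableEmbedding

/-- Up to a null set, the cube is the disjoint union of its ordered chambers. -/
lemma integral_eq_sum_orderedSimplex (hN : Fintype.card ι = N) {H : (ι → I) → ℝ}
    (hH : Integrable H) :
    ∫ t, H t = ∑ e : ι ≃ Fin N, ∫ s in orderedSimplex N, H (s ∘ e) := by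
  let A : (ι ≃ Fin N) → Set (ι → I) := fun e ↦ (fun t ↦ t ∘ e.symm) ⁻¹' orderedSimplex N
  have hA : ∀ e, MeasurableSet (A e) := fun e ↦
    measurableSet_orderedSimplex N |>.preimage (by fun_prop)
  have hcover : (⋃ e, A e) =ᵐ[volume] univ := by
    rw [Filter.eventuallyEq_univ]
    filter_upwards [ae_injective_pi, ae_mem_Ioo_pi] with t h1 h2
    exact mem_iUnion.2 (exists_equiv_comp_mem_orderedSimplex hN h1 h2)
  rw [← setIntegral_univ, ← setIntegral_congr_set hcover, integral_iUnion_fintype hA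
    (fun e e' hee ↦ disjoint_left.2 fun t h h' ↦ hee (equiv_eq_of_comp_mem_orderedSimplex h h'))
    fun e ↦ hH.integrableOn]
  refine Finset.sum_congr rfl fun e _ ↦ ?_
  rw [← (measurePreserving_comp_equiv e).setIntegral_preimage_emb (measurableEmbedding_comp_equiv e)]
  congr 2
  ext s
  simp [A, Function.comp_assoc]

/-- The cube splits into `n!` chambers of equal volume. -/
lemma measureReal_orderedSimplex (n : ℕ) : volume.real (orderedSimplex n) = (n ! : ℝ)⁻¹ := by
  have := integral_eq_sum_orderedSimplex (ι := Fin n) (Fintype.card_fin n)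
    (integrable_const (1 : ℝ))
  simp [Fintype.card_perm] at this
  field_simp
  linarith

end Decomposition

/-! ### Ordered laws are probability measures, compatible under thinning. -/

instance (κ : Profile 𝒳) (n : ℕ) : IsProbabilityMeasure (orderedLaw κ n) := by
  refine ⟨?_⟩
  rw [orderedLaw_eq, Measure.smul_apply, Measure.bind_apply MeasurableSet.univ
    (Kernel.aemeasurable _)]
  have h : volume (orderedSimplex n) = (n ! : ℝ≥0∞)⁻¹ := by
    rw [← ENNReal.toReal_eq_toReal_iff' (measure_ne_top _ _) (by simp [n.factorial_ne_zero])]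
    simpa [Measure.real] using measureReal_orderedSimplex n
  simp [h, ENNReal.mul_inv_cancel, n.factorial_ne_zero]

lemma integral_piKernel_comp_injective {ι ι' : Type*} [Fintype ι] [Fintype ι'] (κ : Profile 𝒳)
    {g : ι → ι'} (hg : Function.Injective g) (f : C(ι → 𝒳, ℝ)) (t : ι' → I) :
    ∫ x, f (x ∘ g) ∂(κ.piKernel ι' t) = ∫ x, f x ∂(κ.piKernel ι (t ∘ g)) := by
  have := measurePreserving_comp_injective (fun i ↦ (κ.law (t i) : Measure 𝒳)) hg
  rw [Profile.piKernel_apply, Profile.piKernel_apply]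
  change _ = ∫ x, f x ∂(Measure.pi fun i ↦ (κ.law (t (g i)) : Measure 𝒳))
  rw [← this.map_eq, integral_map this.measurable.aemeasurable
    f.continuous.aestronglyMeasurable]

lemma integral_thin {k n : ℕ} (μ : Measure (Fin n → 𝒳)) [IsFiniteMeasure μ] (f : C(Fin k → 𝒳, ℝ)) :
    ∫ x, f x ∂(thin k n μ) = (n.choose k : ℝ)⁻¹ * ∑ i : Fin k ↪o Fin n, ∫ x, f (x ∘ i) ∂μ := by
  rw [thin, integral_smul_measure, integral_finsetSum_measure]
  · simp only [ENNReal.toReal_inv, ENNReal.toReal_natCast, smul_eq_mul]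
    congr 2 with i
    exact integral_map (Measurable.aemeasurable (by fun_prop)) f.continuous.aestronglyMeasurable
  · exact fun i _ ↦ f.integrable_of_compactSpace _

lemma comp_mem_orderedSimplex_iff {k n : ℕ} {t : Fin n → I} (ht : t ∈ orderedSimplex n)
    (e : Fin k → Fin n) : t ∘ e ∈ orderedSimplex k ↔ StrictMono e := by
  refine ⟨fun h i j hij ↦ ht.1.lt_iff_lt.1 (h.1 hij), fun h ↦ ⟨ht.1.comp h, fun i ↦ ht.2 _⟩⟩

/-- Selecting coordinates of an ordered point gives an ordered point only when the selection is
increasing, so the indicator kills the other embeddings. -/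
lemma sum_embedding_eq_sum_orderEmbedding {k n : ℕ} {t : Fin n → I} (ht : t ∈ orderedSimplex n)
    (G : (Fin k → I) → ℝ) :
    ∑ e : Fin k ↪ Fin n, (orderedSimplex k).indicator G (t ∘ e) =
      ∑ i : Fin k ↪o Fin n, G (t ∘ i) := by
  symm
  refine Finset.sum_of_injOn (fun i : Fin k ↪o Fin n ↦ i.toEmbedding) ?_ (by simp) ?_ ?_
  · exact fun i _ j _ h ↦ RelEmbedding.toEmbedding_injective h
  · intro e _ he
    refine indicator_of_notMem (fun h ↦ he ?_) _
    rw [comp_mem_orderedSimplex_iff ht] at h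
    exact ⟨OrderEmbedding.ofStrictMono e h, by simp, by ext; rfl⟩
  · intro i _
    refine (indicator_of_mem ?_ _).symm
    exact (comp_mem_orderedSimplex_iff ht _).2 i.strictMono

/-- Averaging over all `k`-subsets of an ordered sample. -/
lemma factorial_mul_integral_sum_orderEmbedding (k n : ℕ) {G : (Fin k → I) → ℝ}
    (hG : Integrable G) :
    n ! * ∫ t in orderedSimplex n, ∑ i : Fin k ↪o Fin n, G (t ∘ i) =
      n.descFactorial k * ∫ s in orderedSimplex k, G s := by
  let F := (orderedSimplex k).indicator G
  have hF : Integrable F := hG.indicator (measurableSet_orderedSimplex k)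
  have hmp : ∀ e : Fin k ↪ Fin n, MeasurePreserving (fun t : Fin n → I ↦ t ∘ e) := fun e ↦
    measurePreserving_comp_injective (fun _ : Fin n ↦ (volume : Measure I)) e.injective
  have hFe : ∀ e : Fin k ↪ Fin n, Integrable fun t : Fin n → I ↦ F (t ∘ e) := fun e ↦
    (hmp e).integrable_comp_of_integrable hF
  -- The integral over the cube of `∑ e, F (t ∘ e)` is computed in two ways. Term by term, each of
  -- the `n.descFactorial k` injective selections is a uniform point of the `k`-cube.
  have h1 : ∫ t : Fin n → I, ∑ e : Fin k ↪ Fin n, F (t ∘ e) =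
      n.descFactorial k * ∫ s in orderedSimplex k, G s := by
    rw [integral_finsetSum _ fun e _ ↦ hFe e]
    have : ∀ e : Fin k ↪ Fin n, ∫ t : Fin n → I, F (t ∘ e) = ∫ s in orderedSimplex k, G s := by
      intro e
      rw [← integral_indicator (measurableSet_orderedSimplex k), ← (hmp e).map_eq,
        integral_map (hmp e).measurable.aemeasurable]
      rw [(hmp e).map_eq]
      exact hF.aestronglyMeasurable
    simp_rw [this]
    simp [Fintype.card_embedding_eq]
  have h2 := integral_eq_sum_orderedSimplex (Fintype.card_fin n)
    (integrable_finsetSum Finset.univ fun e _ ↦ hFe e)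
  rw [← h1, h2]
  -- Chamber by chamber, a permutation of the coordinates only reindexes the embeddings, so all `n!`
  -- chambers contribute equally.
  have h3 : ∀ p : Fin n ≃ Fin n, ∫ s in orderedSimplex n, ∑ e : Fin k ↪ Fin n, F ((s ∘ p) ∘ e) =
      ∫ t in orderedSimplex n, ∑ i : Fin k ↪o Fin n, G (t ∘ i) := by
    intro p
    refine setIntegral_congr_fun (measurableSet_orderedSimplex n) fun s hs ↦ ?_
    rw [← sum_embedding_eq_sum_orderEmbedding hs G]
    exact Fintype.sum_equiv (Equiv.embeddingCongr (Equiv.refl _) p) _ _ fun e ↦ rfl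
  simp [h3, Fintype.card_perm]

/-- A uniform `k`-subset of `n` ordered uniform times is distributed as `k` ordered uniform times,
and the points are independent given the times. -/
lemma thin_orderedLaw (κ : Profile 𝒳) {k n : ℕ} (hkn : k ≤ n) :
    thin k n (orderedLaw κ n) = orderedLaw κ k := by
  have : IsFiniteMeasure (thin k n (orderedLaw κ n)) := by
    have : (n.choose k : ℝ≥0∞)⁻¹ ≠ ∞ := by simp [(Nat.choose_pos hkn).ne']
    exact Measure.smul_finite _ this
  refine Measure.ext_of_forall_integral_continuousMap_eq fun f ↦ ?_
  have hc : (n.choose k : ℝ) ≠ 0 := by exact_mod_cast (Nat.choose_pos hkn).ne'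
  let G : (Fin k → I) → ℝ := fun s ↦ ∫ x, f x ∂(κ.piKernel (Fin k) s)
  have hG : Integrable G := by
    simpa using κ.integrable_moment (integrable_const (1 : ℝ)) f
  have key := factorial_mul_integral_sum_orderEmbedding k n hG
  rw [integral_finsetSum] at key
  swap
  · intro i _
    exact ((measurePreserving_comp_injective (fun _ : Fin n ↦ (volume : Measure I))
      i.injective).integrable_comp_of_integrable hG).integrableOn
  rw [integral_thin, integral_orderedLaw, inv_mul_eq_iff_eq_mul₀ hc, ← mul_assoc,
    mul_comm (n.choose k : ℝ), ← Nat.cast_mul, ← Nat.descFactorial_eq_factorial_mul_choose, ← key,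
    Finset.mul_sum]
  refine Finset.sum_congr rfl fun i _ ↦ ?_
  have := integral_orderedLaw κ n (f.comp ⟨fun x : Fin n → 𝒳 ↦ x ∘ i, by fun_prop⟩)
  refine this.trans ?_
  congr 1
  refine integral_congr_ae (Filter.Eventually.of_forall fun t ↦ ?_)
  exact integral_piKernel_comp_injective κ i.injective f t

/-! ### Products of ordered averages, time moments, and determination of the profile. -/

lemma MeasureTheory.integral_pi_sum_mul {ι ι' Y : Type*} [Fintype ι] [Fintype ι'] [MeasurableSpace Y]
    (μ : ι ⊕ ι' → Measure Y) [∀ i, IsProbabilityMeasure (μ i)] (F : (ι → Y) → ℝ)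
    (G : (ι' → Y) → ℝ) :
    ∫ x, F (x ∘ Sum.inl) * G (x ∘ Sum.inr) ∂(Measure.pi μ) =
      (∫ x, F x ∂(Measure.pi fun i ↦ μ (Sum.inl i))) *
        ∫ x, G x ∂(Measure.pi fun i ↦ μ (Sum.inr i)) := by
  rw [← integral_prod_mul, ← (measurePreserving_sumPiEquivProdPi μ).integral_comp']
  rfl

namespace Profile

lemma moment_congr_ae {ι : Type*} [Fintype ι] (κ : Profile 𝒳) {h h' : (ι → I) → ℝ}
    (hh : h =ᵐ[volume] h') (f : C(ι → 𝒳, ℝ)) : κ.moment h f = κ.moment h' f := by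
  refine integral_congr_ae ?_
  filter_upwards [hh] with t ht
  rw [ht]

lemma moment_sum_mul {ι ι' : Type*} [Fintype ι] [Fintype ι'] (κ : Profile 𝒳) (h : (ι → I) → ℝ)
    (h' : (ι' → I) → ℝ) (f : C(ι → 𝒳, ℝ)) (f' : C(ι' → 𝒳, ℝ)) :
    κ.moment (fun t : ι ⊕ ι' → I ↦ h (t ∘ Sum.inl) * h' (t ∘ Sum.inr))
      ⟨fun x ↦ f (x ∘ Sum.inl) * f' (x ∘ Sum.inr), by fun_prop⟩ = κ.moment h f * κ.moment h' f' := by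
  have := integral_pi_sum_mul (fun _ : ι ⊕ ι' ↦ (volume : Measure I))
    (fun t ↦ h t * ∫ x, f x ∂(κ.piKernel ι t)) (fun t ↦ h' t * ∫ x, f' x ∂(κ.piKernel ι' t))
  refine Eq.trans ?_ this
  refine integral_congr_ae (Filter.Eventually.of_forall fun t ↦ ?_)
  have h2 := integral_pi_sum_mul (fun i : ι ⊕ ι' ↦ (κ.law (t i) : Measure 𝒳)) f f'
  have h3 : ∫ x, f (x ∘ Sum.inl) * f' (x ∘ Sum.inr) ∂(κ.piKernel (ι ⊕ ι') t) =
    (∫ x, f x ∂(κ.piKernel ι (t ∘ Sum.inl))) * ∫ x, f' x ∂(κ.piKernel ι' (t ∘ Sum.inr)) := h2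
  simp only [ContinuousMap.coe_mk, h3]
  ring

/-- A moment against a function of the relative order of the times is a moment of an ordered law. -/
lemma exists_moment_eq_integral_orderedLaw {ι : Type*} [Fintype ι] {N : ℕ}
    (hN : Fintype.card ι = N) {h : (ι → I) → ℝ} (hh : Integrable h)
    (hord : ∀ s t : ι → I, (∀ i j, s i < s j ↔ t i < t j) → h s = h t) (f : C(ι → 𝒳, ℝ)) :
    ∃ g : C(Fin N → 𝒳, ℝ), ∀ κ : Profile 𝒳, κ.moment h f = ∫ x, g x ∂(orderedLaw κ N) := by
  classical
  have hne : (orderedSimplex N).Nonempty := by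
    refine nonempty_of_measureReal_ne_zero (μ := volume) ?_
    rw [measureReal_orderedSimplex]
    positivity
  obtain ⟨s₀, hs₀⟩ := hne
  let fe : (ι ≃ Fin N) → C(Fin N → 𝒳, ℝ) := fun e ↦ ⟨fun x ↦ f (x ∘ e), by fun_prop⟩
  -- On the chamber of `e`, `h` has the constant value `h (s₀ ∘ e)` for any ordered `s₀`; the factor
  -- `(N !)⁻¹` undoes the normalization of the ordered law.
  refine ⟨∑ e : ι ≃ Fin N, ((N ! : ℝ)⁻¹ * h (s₀ ∘ e)) • fe e, fun κ ↦ ?_⟩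
  rw [moment, integral_eq_sum_orderedSimplex hN (κ.integrable_moment hh f)]
  simp only [ContinuousMap.coe_sum, ContinuousMap.coe_smul, Finset.sum_apply, Pi.smul_apply]
  rw [integral_finsetSum]
  swap
  · exact fun e _ ↦ ((fe e).integrable_of_compactSpace _).const_mul _
  refine Finset.sum_congr rfl fun e _ ↦ ?_
  rw [integral_smul, integral_orderedLaw, smul_eq_mul, ← mul_assoc, mul_right_comm _ (h _),
    inv_mul_cancel₀ (by positivity), one_mul, ← integral_const_mul]
  refine setIntegral_congr_fun (measurableSet_orderedSimplex N) fun s hs ↦ ?_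
  have h1 : h (s ∘ e) = h (s₀ ∘ e) := hord _ _ fun i j ↦ by
    simp [hs.1.lt_iff_lt, hs₀.1.lt_iff_lt]
  simp only [h1]
  congr 1
  exact (integral_piKernel_comp_injective κ e.injective f s).symm

end Profile

/-- Discarding the null constraint at the endpoints leaves a function of the relative order of the
times alone. -/
lemma indicator_orderedSimplex_ae_eq (n : ℕ) :
    (orderedSimplex n).indicator (1 : (Fin n → I) → ℝ) =ᵐ[volume]
      {t | StrictMono t}.indicator 1 := by
  filter_upwards [ae_mem_Ioo_pi] with t ht
  by_cases h : StrictMono t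
  · rw [indicator_of_mem (show t ∈ orderedSimplex n from ⟨h, ht⟩), indicator_of_mem (by exact h)]
  · rw [indicator_of_notMem (fun h' ↦ h h'.1), indicator_of_notMem (by exact h)]

/-- The product is a moment over `n + m` independent times, against the indicator that the first `n`
and the last `m` are each increasing. That indicator depends only on the relative order of all the
times. -/
lemma exists_mul_integral_orderedLaw {n m : ℕ} (f : C(Fin n → 𝒳, ℝ)) (f' : C(Fin m → 𝒳, ℝ)) :
    ∃ g : C(Fin (n + m) → 𝒳, ℝ), ∀ κ : Profile 𝒳,
      (∫ x, f x ∂(orderedLaw κ n)) * ∫ x, f' x ∂(orderedLaw κ m) =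
        ∫ x, g x ∂(orderedLaw κ (n + m)) := by
  let h : (Fin n ⊕ Fin m → I) → ℝ := fun t ↦
    {t | StrictMono t}.indicator 1 (t ∘ Sum.inl) * {t | StrictMono t}.indicator 1 (t ∘ Sum.inr)
  have hint : ∀ n : ℕ, Integrable ({t : Fin n → I | StrictMono t}.indicator (1 : (Fin n → I) → ℝ)) :=
    fun n ↦ (integrable_indicator_orderedSimplex n).congr (indicator_orderedSimplex_ae_eq n)
  have hh : Integrable h := by
    have := ((hint n).mul_prod (hint m))
    exact (measurePreserving_sumPiEquivProdPi fun _ : Fin n ⊕ Fin m ↦ (volume : Measure I)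
      ).integrable_comp_of_integrable this
  have hind : ∀ (n : ℕ) (s t : Fin n → I), (∀ i j, s i < s j ↔ t i < t j) →
      {t : Fin n → I | StrictMono t}.indicator (1 : (Fin n → I) → ℝ) s =
        {t : Fin n → I | StrictMono t}.indicator 1 t := by
    intro n s t hst
    have : StrictMono s ↔ StrictMono t :=
      ⟨fun h i j hij ↦ (hst i j).1 (h hij), fun h i j hij ↦ (hst i j).2 (h hij)⟩
    by_cases hs : StrictMono s
    · rw [indicator_of_mem (by exact hs), indicator_of_mem (by exact this.1 hs)]; rfl
    · rw [indicator_of_notMem (by exact hs), indicator_of_notMem (by exact fun h ↦ hs (this.2 h))]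
  obtain ⟨g, hg⟩ := Profile.exists_moment_eq_integral_orderedLaw (𝒳 := 𝒳) (N := n + m) (by simp) hh
    (fun s t hst ↦ by
      simp only [h]
      rw [hind n (s ∘ Sum.inl) (t ∘ Sum.inl) fun i j ↦ hst _ _,
        hind m (s ∘ Sum.inr) (t ∘ Sum.inr) fun i j ↦ hst _ _])
    ⟨fun x ↦ f (x ∘ Sum.inl) * f' (x ∘ Sum.inr), by fun_prop⟩
  refine ⟨((n ! : ℝ) * m !) • g, fun κ ↦ ?_⟩
  rw [integral_orderedLaw_eq_moment, integral_orderedLaw_eq_moment,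
    κ.moment_congr_ae (indicator_orderedSimplex_ae_eq n),
    κ.moment_congr_ae (indicator_orderedSimplex_ae_eq m), mul_mul_mul_comm, ← κ.moment_sum_mul, hg]
  simp only [ContinuousMap.coe_smul, Pi.smul_apply, smul_eq_mul, integral_const_mul]

/-- Time moments of a profile are moments of its ordered laws. -/
lemma exists_integral_pow_eq_integral_orderedLaw (a : ℕ) (f : C(𝒳, ℝ)) :
    ∃ g : C(Fin (a + 1) → 𝒳, ℝ), ∀ κ : Profile 𝒳,
      ∫ s : I, (s : ℝ) ^ a * ∫ x, f x ∂(κ.law s : Measure 𝒳) = ∫ x, g x ∂(orderedLaw κ (a + 1)) := by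
  -- The event that time `0` is the latest. Given `t 0 = s` it has probability `s ^ a`, which
  -- produces the time moment.
  let B : Set (Fin (a + 1) → I) := ⋂ j : Fin a, {t | t j.succ < t 0}
  have hB : MeasurableSet B := MeasurableSet.iInter fun j ↦
    measurableSet_lt (by fun_prop) (by fun_prop)
  obtain ⟨g, hg⟩ := Profile.exists_moment_eq_integral_orderedLaw (𝒳 := 𝒳) (ι := Fin (a + 1))
    (h := B.indicator 1) (Fintype.card_fin _) ((integrable_const (1 : ℝ)).indicator hB)
    (fun s t hst ↦ by
      have : s ∈ B ↔ t ∈ B := by simp [B, hst]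
      by_cases hs : s ∈ B
      · rw [indicator_of_mem hs, indicator_of_mem (this.1 hs)]; rfl
      · rw [indicator_of_notMem hs, indicator_of_notMem (fun h ↦ hs (this.2 h))])
    (f.comp ⟨fun x ↦ x 0, by fun_prop⟩)
  refine ⟨g, fun κ ↦ ?_⟩
  rw [← hg, Profile.moment]
  let c : I → ℝ := fun s ↦ ∫ x, f x ∂(κ.law s : Measure 𝒳)
  have h1 : ∀ t : Fin (a + 1) → I,
      ∫ x, (f.comp ⟨fun x : Fin (a + 1) → 𝒳 ↦ x 0, by fun_prop⟩) x ∂(κ.piKernel (Fin (a + 1)) t) =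
        c (t 0) := by
    intro t
    have := measurePreserving_eval (fun i ↦ (κ.law (t i) : Measure 𝒳)) 0
    simp only [c]
    rw [← this.map_eq, integral_map this.measurable.aemeasurable f.continuous.aestronglyMeasurable]
    rfl
  simp_rw [h1]
  have h2 : ∀ t : Fin (a + 1) → I, B.indicator (1 : (Fin (a + 1) → I) → ℝ) t * c (t 0) =
      c (t 0) * ∏ j : Fin a, (Iio (t 0)).indicator (1 : I → ℝ) (t j.succ) := by
    intro t
    rw [mul_comm]
    congr 1
    by_cases ht : t ∈ B
    · rw [indicator_of_mem ht]
      have h3 : ∀ j : Fin a, t j.succ ∈ Iio (t 0) := fun j ↦ by simpa using mem_iInter.1 ht j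
      refine (Finset.prod_eq_one fun j _ ↦ ?_).symm
      rw [indicator_of_mem (h3 j), Pi.one_apply]
    · rw [indicator_of_notMem ht]
      obtain ⟨j, hj⟩ := not_forall.1 fun h ↦ ht (mem_iInter.2 h)
      exact (Finset.prod_eq_zero (Finset.mem_univ j) (indicator_of_notMem (show t j.succ ∉ Iio (t 0) from hj) _)).symm
  have hc : Integrable c := by
    have := κ.stronglyMeasurable_law.measurable
    refine Integrable.of_bound (C := ‖f‖) ?_ (Filter.Eventually.of_forall fun s ↦ ?_)
    · exact ((ProbabilityMeasure.measurable_integral_continuousMap f).comp this).aestronglyMeasurable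
    · simpa using norm_integral_le_of_norm_le_const (μ := (κ.law s : Measure 𝒳)) (f := f) (C := ‖f‖)
        (Filter.Eventually.of_forall fun x ↦ f.norm_coe_le_norm x)
  have hmp := volume_preserving_piFinSuccAbove (fun _ : Fin (a + 1) ↦ I) 0
  let Ψ : I × (Fin a → I) → ℝ := fun p ↦ c p.1 * ∏ j, (Iio p.1).indicator (1 : I → ℝ) (p.2 j)
  have hΨ : Integrable Ψ := by
    refine (hc.comp_fst _).mul_bdd (c := 1) ?_ (Filter.Eventually.of_forall fun p ↦ ?_)
    · refine Measurable.aestronglyMeasurable (Finset.measurable_fun_prod _ fun j _ ↦ ?_)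
      have : MeasurableSet {p : I × (Fin a → I) | p.2 j < p.1} :=
        measurableSet_lt (by fun_prop) (by fun_prop)
      exact (measurable_one (α := ℝ)).indicator this
    · rw [norm_prod]
      refine Finset.prod_le_one (fun _ _ ↦ norm_nonneg _) fun j _ ↦ ?_
      by_cases h : p.2 j ∈ Iio p.1 <;> simp [h]
  calc ∫ s : I, (s : ℝ) ^ a * c s = ∫ p, Ψ p := by
        rw [Measure.volume_eq_prod, integral_prod _ hΨ]
        refine integral_congr_ae (Filter.Eventually.of_forall fun s ↦ ?_)
        simp only [Ψ]
        rw [integral_const_mul, integral_fin_nat_prod_volume_eq_prod]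
        simp [integral_indicator, measurableSet_Iio, Measure.real, s.2.1, mul_comm]
    _ = ∫ t : Fin (a + 1) → I, Ψ (t 0, fun j ↦ t j.succ) := (hmp.integral_comp' Ψ).symm
    _ = _ := by simp_rw [h2]; rfl

namespace Profile

/-- By Weierstrass the powers may be replaced by any continuous `u` of the time, and the products
`u(t) f(x)` determine the Young measure. -/
lemma ext_of_integral_pow {κ κ' : Profile 𝒳} (h : ∀ (a : ℕ) (f : C(𝒳, ℝ)),
    ∫ s : I, (s : ℝ) ^ a * ∫ x, f x ∂(κ.law s : Measure 𝒳) =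
      ∫ s : I, (s : ℝ) ^ a * ∫ x, f x ∂(κ'.law s : Measure 𝒳)) : κ = κ' := by
  have hm : ∀ (κ : Profile 𝒳) (u : C(I, ℝ)) (f : C(𝒳, ℝ)),
      ∫ z : I × 𝒳, u z.1 * f z.2 ∂(κ.young : Measure (I × 𝒳)) =
        ∫ s, u s * ∫ x, f x ∂(κ.law s : Measure 𝒳) := by
    intro κ u f
    refine (κ.integral_young ⟨fun z ↦ u z.1 * f z.2, by fun_prop⟩).trans ?_
    simp [integral_const_mul]
  let L : Profile 𝒳 → C(𝒳, ℝ) → C(I, ℝ) → ℝ := fun κ f u ↦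
    ∫ z : I × 𝒳, u z.1 * f z.2 ∂(κ.young : Measure (I × 𝒳))
  have hint : ∀ (κ : Profile 𝒳) (u : C(I, ℝ)) (f : C(𝒳, ℝ)),
      Integrable (fun z : I × 𝒳 ↦ u z.1 * f z.2) (κ.young : Measure (I × 𝒳)) := fun κ u f ↦
    ContinuousMap.integrable_of_compactSpace ⟨fun z : I × 𝒳 ↦ u z.1 * f z.2, by fun_prop⟩ _
  have hL : ∀ κ f, Continuous (L κ f) := by
    intro κ f
    have h1 : Continuous fun u : C(I, ℝ) ↦ (u.comp ContinuousMap.fst : C(I × 𝒳, ℝ)) *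
        f.comp ContinuousMap.snd := by fun_prop
    exact (ContinuousMap.lipschitzWith_integral (κ.young : Measure (I × 𝒳))).continuous.comp h1
  have hpoly : ∀ (f : C(𝒳, ℝ)) (p : Polynomial ℝ),
      L κ f (p.toContinuousMapOn I) = L κ' f (p.toContinuousMapOn I) := by
    intro f p
    induction p using Polynomial.induction_on' with
    | add p q hp hq =>
      have key : ∀ κ, L κ f ((p + q).toContinuousMapOn I) =
          L κ f (p.toContinuousMapOn I) + L κ f (q.toContinuousMapOn I) := fun κ ↦ by
        simp only [L]
        rw [← integral_add (hint _ _ _) (hint _ _ _)]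
        congr with z
        simp [add_mul]
      rw [key, key, hp, hq]
    | monomial a b =>
      have key : ∀ κ, L κ f ((Polynomial.monomial a b).toContinuousMapOn I) =
          b * ∫ s : I, (s : ℝ) ^ a * ∫ x, f x ∂(κ.law s : Measure 𝒳) := fun κ ↦ by
        simp only [L]
        rw [hm, ← integral_const_mul]
        congr with z
        simp [mul_assoc]
      rw [key, key, h]
  have hall : ∀ (u : C(I, ℝ)) (f : C(𝒳, ℝ)), L κ f u = L κ' f u := by
    intro u f
    have hu : u ∈ (polynomialFunctions I).topologicalClosure := by
      rw [polynomialFunctions.topologicalClosure]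
      trivial
    refine closure_minimal (s := (polynomialFunctions I : Set C(I, ℝ)))
      (t := {u | L κ f u = L κ' f u}) ?_ (isClosed_eq (hL κ f) (hL κ' f)) hu
    rw [polynomialFunctions_coe]
    rintro _ ⟨p, rfl⟩
    exact hpoly f p
  refine young_injective (Subtype.ext (Measure.ext_of_integral_mul_boundedContinuousFunction
    (μ := (κ.young : Measure (I × 𝒳))) (ν := (κ'.young : Measure (I × 𝒳))) fun u f ↦ ?_))
  exact hall u.toContinuousMap f.toContinuousMap

/-- A profile is determined by its ordered laws. -/
lemma ext_of_orderedLaw {κ κ' : Profile 𝒳} (h : ∀ n : ℕ+, orderedLaw κ n = orderedLaw κ' n) :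
    κ = κ' := by
  refine ext_of_integral_pow fun a f ↦ ?_
  obtain ⟨g, hg⟩ := exists_integral_pow_eq_integral_orderedLaw a f
  rw [hg, hg]
  exact congrArg (fun μ ↦ ∫ x, g x ∂μ) (h ⟨a + 1, a.succ_pos⟩)

end Profile

/-! ### Stone–Weierstrass and uniqueness of the mixing measure. -/

/-- The functional `κ ↦ ∫ f dκ^{[n]}`. -/
def orderedEval (n : ℕ) (f : C(Fin n → 𝒳, ℝ)) : C(Profile 𝒳, ℝ) :=
  ⟨fun κ ↦ ∫ x, f x ∂(orderedLaw κ n), continuous_integral_orderedLaw n f⟩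

lemma orderedEval_apply (n : ℕ) (f : C(Fin n → 𝒳, ℝ)) (κ : Profile 𝒳) :
    orderedEval n f κ = ∫ x, f x ∂(orderedLaw κ n) := rfl

lemma orderedEval_algebraMap (n : ℕ) (c : ℝ) :
    orderedEval n (algebraMap ℝ C(Fin n → 𝒳, ℝ) c) = algebraMap ℝ C(Profile 𝒳, ℝ) c := by
  ext κ
  simp [orderedEval_apply]

lemma orderedEval_add (n : ℕ) (f f' : C(Fin n → 𝒳, ℝ)) :
    orderedEval n (f + f') = orderedEval n f + orderedEval n f' := by
  ext κ
  exact integral_add (f.integrable_of_compactSpace _) (f'.integrable_of_compactSpace _)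

lemma exists_orderedEval_mul {n m : ℕ} (f : C(Fin n → 𝒳, ℝ)) (f' : C(Fin m → 𝒳, ℝ)) :
    ∃ g : C(Fin (n + m) → 𝒳, ℝ), orderedEval n f * orderedEval m f' = orderedEval (n + m) g := by
  obtain ⟨g, hg⟩ := exists_mul_integral_orderedLaw f f'
  exact ⟨g, ContinuousMap.ext hg⟩

/-- Multiplying by the constant `1` of order `m` raises the order, so that averages of different
orders can be added. -/
lemma exists_orderedEval_eq_add {n : ℕ} (f : C(Fin n → 𝒳, ℝ)) (m : ℕ) :
    ∃ g : C(Fin (n + m) → 𝒳, ℝ), orderedEval n f = orderedEval (n + m) g := by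
  obtain ⟨g, hg⟩ := exists_orderedEval_mul f (algebraMap ℝ C(Fin m → 𝒳, ℝ) 1)
  exact ⟨g, by rw [← hg, orderedEval_algebraMap, map_one, mul_one]⟩

variable (𝒳) in
/-- The functionals of the ordered laws form an algebra. -/
def orderedEvalSubalgebra : Subalgebra ℝ C(Profile 𝒳, ℝ) where
  carrier := {u | ∃ (n : ℕ+) (f : C(Fin n → 𝒳, ℝ)), u = orderedEval n f}
  mul_mem' := by
    rintro _ _ ⟨n, f, rfl⟩ ⟨m, f', rfl⟩
    obtain ⟨g, hg⟩ := exists_orderedEval_mul f f'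
    exact ⟨n + m, g, hg⟩
  add_mem' := by
    rintro _ _ ⟨n, f, rfl⟩ ⟨m, f', rfl⟩
    obtain ⟨g, hg⟩ := exists_orderedEval_eq_add f m
    obtain ⟨g', hg'⟩ : ∃ g' : C(Fin (n + m) → 𝒳, ℝ), orderedEval m f' = orderedEval (n + m) g' := by
      rw [add_comm (n : ℕ)]
      exact exists_orderedEval_eq_add f' n
    exact ⟨n + m, g + g', by rw [hg, hg', ← orderedEval_add]; rfl⟩
  algebraMap_mem' c := ⟨1, _, (orderedEval_algebraMap 1 c).symm⟩

/-- Stone–Weierstrass applies because the ordered laws separate profiles. -/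
lemma orderedEvalSubalgebra_topologicalClosure :
    (orderedEvalSubalgebra 𝒳).topologicalClosure = ⊤ := by
  refine ContinuousMap.subalgebra_topologicalClosure_eq_top_of_separatesPoints _ fun κ κ' hne ↦ ?_
  by_contra! hcon
  refine hne (Profile.ext_of_orderedLaw fun n ↦
    Measure.ext_of_forall_integral_continuousMap_eq fun f ↦ ?_)
  exact hcon _ ⟨orderedEval n f, ⟨n, f, rfl⟩, rfl⟩

/-- A probability measure on profiles is determined by the averages of the ordered laws. -/
lemma eq_of_forall_integral_orderedEval_eq {P P' : Measure (Profile 𝒳)} [IsProbabilityMeasure P]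
    [IsProbabilityMeasure P']
    (h : ∀ (n : ℕ+) (f : C(Fin n → 𝒳, ℝ)),
      ∫ κ, orderedEval n f κ ∂P = ∫ κ, orderedEval n f κ ∂P') : P = P' := by
  let := TopologicalSpace.metrizableSpaceMetric (Profile 𝒳)
  refine Measure.ext_of_forall_integral_continuousMap_eq fun u ↦ ?_
  have hu : u ∈ (orderedEvalSubalgebra 𝒳).topologicalClosure := by
    rw [orderedEvalSubalgebra_topologicalClosure]
    trivial
  refine closure_minimal (s := (orderedEvalSubalgebra 𝒳 : Set C(Profile 𝒳, ℝ)))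
    (t := {u | ∫ κ, u κ ∂P = ∫ κ, u κ ∂P'}) ?_
    (isClosed_eq (ContinuousMap.lipschitzWith_integral P).continuous
      (ContinuousMap.lipschitzWith_integral P').continuous) hu
  rintro _ ⟨n, f, rfl⟩
  exact h n f

/-! ### Step profiles and existence of a mixing measure. -/

lemma MeasureTheory.Measure.pi_dirac {ι Y : Type*} [Fintype ι] [MeasurableSpace Y] (x : ι → Y) :
    Measure.pi (fun i ↦ Measure.dirac (x i)) = Measure.dirac x := by
  refine Measure.pi_eq fun s hs ↦ ?_
  rw [Measure.dirac_apply' _ (MeasurableSet.univ_pi hs)]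
  simp_rw [Measure.dirac_apply' _ (hs _)]
  by_cases h : ∀ i, x i ∈ s i
  · rw [indicator_of_mem (by simpa using h)]
    exact (Finset.prod_eq_one fun i _ ↦ indicator_of_mem (h i) _).symm
  · rw [indicator_of_notMem (by simpa using h)]
    obtain ⟨i, hi⟩ := not_forall.1 h
    exact (Finset.prod_eq_zero (Finset.mem_univ i) (indicator_of_notMem hi _)).symm

lemma tendsto_descFactorial_div_pow (k : ℕ) :
    Filter.Tendsto (fun n : ℕ ↦ (n.descFactorial k : ℝ) / (n : ℝ) ^ k) Filter.atTop (𝓝 1) := by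
  have h1 : ∀ n : ℕ, (n.descFactorial k : ℝ) / (n : ℝ) ^ k =
      ∏ i ∈ Finset.range k, ((n - i : ℕ) : ℝ) / n := by
    intro n
    rw [Nat.descFactorial_eq_prod_range, Finset.prod_div_distrib]
    simp
  simp_rw [h1]
  rw [← Finset.prod_const_one (s := Finset.range k) (M := ℝ)]
  refine tendsto_finsetProd _ fun i _ ↦ ?_
  have h2 : Filter.Tendsto (fun n : ℕ ↦ 1 - (i : ℝ) / n) Filter.atTop (𝓝 (1 - 0)) :=
    tendsto_const_nhds.sub (tendsto_const_div_atTop_nhds_zero_nat _)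
  rw [sub_zero] at h2
  refine h2.congr' ?_
  filter_upwards [Filter.eventually_ge_atTop (i + 1)] with n hn
  rw [Nat.cast_sub (by omega), sub_div, div_self]
  exact_mod_cast (by omega : n ≠ 0)

/-- The number of the cell of the partition of `[0,1]` into `n` intervals of equal length. -/
def cellIndex (n : ℕ) [NeZero n] (t : I) : Fin n :=
  -- The minimum matters only at `t = 1`, where the floor is `n`.
  ⟨min ⌊n * (t : ℝ)⌋₊ (n - 1), by have := NeZero.pos n; omega⟩

section CellIndex

variable {n : ℕ} [NeZero n]

lemma monotone_cellIndex : Monotone (cellIndex n) := by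
  intro s t hst
  refine Fin.mk_le_mk.2 (min_le_min_right _ (Nat.floor_mono ?_))
  gcongr

@[fun_prop]
lemma measurable_cellIndex : Measurable (cellIndex n) := monotone_cellIndex.measurable

lemma cellIndex_eq_iff {t : I} (ht : t < 1) (i : Fin n) :
    cellIndex n t = i ↔ ((i : ℕ) / n : ℝ) ≤ t ∧ (t : ℝ) < ((i : ℕ) + 1 : ℝ) / n := by
  have hn : (0 : ℝ) < n := by exact_mod_cast NeZero.pos n
  have ht' : (t : ℝ) < 1 := ht
  have h1 : ⌊n * (t : ℝ)⌋₊ < n := by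
    rw [Nat.floor_lt (by have := t.2.1; positivity)]
    nlinarith
  have h2 : (cellIndex n t : ℕ) = ⌊n * (t : ℝ)⌋₊ := min_eq_left (by omega)
  rw [Fin.ext_iff, h2, Nat.floor_eq_iff
    (by have := t.2.1; positivity), div_le_iff₀ hn, lt_div_iff₀ hn, mul_comm (t : ℝ)]

lemma measureReal_cellIndex_eq (i : Fin n) :
    (volume : Measure I).real {t | cellIndex n t = i} = (n : ℝ)⁻¹ := by
  have hn : (0 : ℝ) < n := by exact_mod_cast NeZero.pos n
  have hi : ((i : ℕ) : ℝ) + 1 ≤ n := by exact_mod_cast i.2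
  let a : I := ⟨(i : ℕ) / n, by positivity, by rw [div_le_one hn]; linarith⟩
  let b : I := ⟨((i : ℕ) + 1) / n, by positivity, by rw [div_le_one hn]; linarith⟩
  have : {t | cellIndex n t = i} =ᵐ[volume] Ico a b := by
    filter_upwards [Measure.ae_ne volume (1 : I)] with t ht
    exact propext (cellIndex_eq_iff (unitInterval.lt_one_iff_ne_one.2 ht) i)
  rw [measureReal_congr this, Measure.real, unitInterval.volume_Ico]
  simp only [a, b]
  rw [← sub_div, add_sub_cancel_left, ENNReal.toReal_ofReal (by positivity), one_div]

lemma measureReal_cellIndex_comp_eq {k : ℕ} (i : Fin k → Fin n) :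
    (volume : Measure (Fin k → I)).real {t | cellIndex n ∘ t = i} = ((n : ℝ) ^ k)⁻¹ := by
  have : {t : Fin k → I | cellIndex n ∘ t = i} = univ.pi fun j ↦ {s | cellIndex n s = i j} := by
    ext t
    simp [funext_iff]
  rw [this, Measure.real, volume_pi_pi, ENNReal.toReal_prod]
  simp_rw [← Measure.real_def, measureReal_cellIndex_eq]
  simp

lemma mem_orderedSimplex_ae_of_cellIndex_strictMono {k : ℕ} :
    ∀ᵐ t : Fin k → I, StrictMono (cellIndex n ∘ t) → t ∈ orderedSimplex k := by
  filter_upwards [ae_mem_Ioo_pi] with t ht h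
  exact ⟨fun i j hij ↦ monotone_cellIndex.reflect_lt (h hij), ht⟩

end CellIndex

/-- The averaging identity over `k`-subsets, with constant integrand `1`. -/
lemma card_orderEmbedding_fin (k n : ℕ) :
    (k ! * Fintype.card (Fin k ↪o Fin n) : ℝ) = n.descFactorial k := by
  have h := factorial_mul_integral_sum_orderEmbedding k n (integrable_const (1 : ℝ))
  simp [measureReal_orderedSimplex] at h
  have h1 : (n ! : ℝ) ≠ 0 := by positivity
  have h2 : (k ! : ℝ) ≠ 0 := by positivity
  field_simp at h
  linarith

/-- The profile running through the points `x_1, …, x_n` at constant speed. -/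
def stepProfile {n : ℕ} [NeZero n] (x : Fin n → 𝒳) : Profile 𝒳 :=
  Profile.ofMeasurable (fun t ↦ diracProba (x (cellIndex n t)))
    ((measurable_of_finite fun i ↦ diracProba (x i)).comp measurable_cellIndex)

lemma law_stepProfile {n : ℕ} [NeZero n] (x : Fin n → 𝒳) :
    (stepProfile x).law =ᵐ[volume] fun t ↦ diracProba (x (cellIndex n t)) :=
  Profile.law_ofMeasurable _ _

lemma continuous_stepProfile {n : ℕ} [NeZero n] :
    Continuous (stepProfile : (Fin n → 𝒳) → Profile 𝒳) := by
  rw [Profile.isInducing_young.continuous_iff,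
    ProbabilityMeasure.continuous_iff_forall_continuousMap_continuous_integral]
  intro f
  have : ∀ x : Fin n → 𝒳, ∫ z, f z ∂((stepProfile x).young : Measure (I × 𝒳)) =
      ∫ t, f (t, x (cellIndex n t)) := by
    intro x
    rw [Profile.integral_young]
    refine integral_congr_ae ?_
    filter_upwards [law_stepProfile x] with t ht
    rw [ht]
    exact integral_dirac _ _
  simp only [Function.comp_apply, this]
  refine continuous_of_dominated (bound := fun _ ↦ ‖f‖) (fun x ↦ ?_) (fun x ↦ ?_)
    (integrable_const _) ?_
  · have : Measurable fun t : I ↦ x (cellIndex n t) :=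
      (measurable_of_finite x).comp measurable_cellIndex
    exact (f.continuous.measurable.comp (measurable_id.prodMk this)).aestronglyMeasurable
  · exact Filter.Eventually.of_forall fun t ↦ f.norm_coe_le_norm _
  · exact Filter.Eventually.of_forall fun t ↦ by fun_prop

lemma integral_orderedLaw_stepProfile {n : ℕ} [NeZero n] (x : Fin n → 𝒳) {k : ℕ}
    (f : C(Fin k → 𝒳, ℝ)) :
    ∫ y, f y ∂(orderedLaw (stepProfile x) k) =
      k ! * ∫ t in orderedSimplex k, f (x ∘ cellIndex n ∘ t) := by
  rw [integral_orderedLaw]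
  congr 1
  refine integral_congr_ae (ae_restrict_of_ae ?_)
  have : ∀ᵐ t : Fin k → I, ∀ i, (stepProfile x).law (t i) = diracProba (x (cellIndex n (t i))) :=
    ae_all_iff.2 fun i ↦ (measurePreserving_eval (fun _ : Fin k ↦ (volume : Measure I)) i
      ).quasiMeasurePreserving.ae (law_stepProfile x)
  filter_upwards [this] with t ht
  simp_rw [Profile.piKernel_apply, ht]
  have h2 : Measure.pi (fun i ↦ (diracProba (x (cellIndex n (t i))) : Measure 𝒳)) =
    Measure.dirac (x ∘ cellIndex n ∘ t) := Measure.pi_dirac (x ∘ cellIndex n ∘ t)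
  rw [h2, integral_dirac]

/-- If the ordered times fall in distinct cells, the cells visited are an increasing `k`-tuple, each
with probability `k! / n ^ k`. The remaining event, two times in one cell, has probability `1 -
n.descFactorial k / n ^ k` and costs at most `‖f‖` times that. -/
lemma abs_integral_orderedLaw_stepProfile_sub_le {n : ℕ} [NeZero n] (x : Fin n → 𝒳) {k : ℕ}
    (f : C(Fin k → 𝒳, ℝ)) :
    |∫ y, f y ∂(orderedLaw (stepProfile x) k) -
      k ! * ((n : ℝ) ^ k)⁻¹ * ∑ i : Fin k ↪o Fin n, f (x ∘ i)| ≤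
        ‖f‖ * (1 - n.descFactorial k / (n : ℝ) ^ k) := by
  let B : (Fin k ↪o Fin n) → Set (Fin k → I) := fun i ↦ {t | cellIndex n ∘ t = i}
  -- The times whose cells are strictly increasing; up to a null set they lie in the ordered
  -- simplex.
  let A : Set (Fin k → I) := ⋃ i, B i
  have hB : ∀ i, MeasurableSet (B i) := fun i ↦ by
    have : Measurable fun t : Fin k → I ↦ cellIndex n ∘ t :=
      measurable_pi_lambda _ fun j ↦ measurable_cellIndex.comp (measurable_pi_apply j)
    exact this (measurableSet_singleton _)
  have hdisj : Pairwise (Function.onFun Disjoint B) := fun i j hij ↦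
    disjoint_left.2 fun t (h : _ = _) (h' : _ = _) ↦ hij (DFunLike.coe_injective (h.symm.trans h'))
  have hA : MeasurableSet A := MeasurableSet.iUnion hB
  have hAle : A ≤ᵐ[volume] orderedSimplex k := by
    filter_upwards [mem_orderedSimplex_ae_of_cellIndex_strictMono (n := n)] with t ht h
    obtain ⟨i, hi⟩ := mem_iUnion.1 h
    refine ht ?_
    rw [show cellIndex n ∘ t = i from hi]
    exact i.strictMono
  let F : (Fin k → I) → ℝ := fun t ↦ f (x ∘ cellIndex n ∘ t)
  have hFint : Integrable F := by
    refine Integrable.of_bound (C := ‖f‖) ?_ (Filter.Eventually.of_forall fun t ↦ f.norm_coe_le_norm _)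
    have : Measurable fun t : Fin k → I ↦ x ∘ cellIndex n ∘ t := measurable_pi_lambda _ fun j ↦
      (measurable_of_finite x).comp (measurable_cellIndex.comp (measurable_pi_apply j))
    exact (f.continuous.measurable.comp this).aestronglyMeasurable
  have hFA : ∫ t in A, F t = ((n : ℝ) ^ k)⁻¹ * ∑ i : Fin k ↪o Fin n, f (x ∘ i) := by
    rw [integral_iUnion_fintype hB hdisj fun i ↦ hFint.integrableOn, Finset.mul_sum]
    refine Finset.sum_congr rfl fun i _ ↦ ?_
    rw [setIntegral_congr_fun (g := fun _ ↦ f (x ∘ i)) (hB i)]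
    · rw [setIntegral_const, measureReal_cellIndex_comp_eq, smul_eq_mul]
    · intro t ht
      simp only [F]
      rw [show cellIndex n ∘ t = i from ht]
  have hvA : volume.real A = ((n : ℝ) ^ k)⁻¹ * Fintype.card (Fin k ↪o Fin n) := by
    rw [measureReal_iUnion_fintype hdisj hB]
    simp [B, measureReal_cellIndex_comp_eq, mul_comm]
  have hΔA : (orderedSimplex k ∩ A : Set (Fin k → I)) =ᵐ[volume] A := by
    filter_upwards [hAle] with t ht
    exact propext ⟨fun h ↦ h.2, fun h ↦ ⟨ht h, h⟩⟩
  have hdiff : ∫ t in orderedSimplex k, F t = (∫ t in A, F t) + ∫ t in orderedSimplex k \ A, F t := by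
    rw [← setIntegral_congr_set hΔA]
    exact (integral_inter_add_sdiff hA hFint.integrableOn).symm
  have hvd : volume.real (orderedSimplex k \ A) = (k ! : ℝ)⁻¹ - volume.real A := by
    rw [← measureReal_orderedSimplex, ← measureReal_inter_add_sdiff (s := orderedSimplex k) hA,
      measureReal_congr hΔA, add_sub_cancel_left]
  have hk : (0 : ℝ) < k ! := by positivity
  rw [integral_orderedLaw_stepProfile, mul_assoc, ← hFA, hdiff, ← mul_sub, add_sub_cancel_left, abs_mul,
    abs_of_pos hk]
  calc k ! * |∫ t in orderedSimplex k \ A, F t|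
      ≤ k ! * (‖f‖ * volume.real (orderedSimplex k \ A)) := by
        gcongr
        exact norm_setIntegral_le_of_norm_le_const (measure_lt_top _ _) fun t _ ↦ f.norm_coe_le_norm _
    _ = ‖f‖ * (1 - n.descFactorial k / (n : ℝ) ^ k) := by
        rw [hvd, hvA, ← card_orderEmbedding_fin]
        field_simp

/-- Every thinning-invariant array is a mixture of ordered laws. -/
lemma exists_integral_orderedEval_eq (m : TriangularArray 𝒳) (hm : ThinningInvariant m) :
    ∃ P : ProbabilityMeasure (Profile 𝒳), ∀ (k : ℕ+) (f : C(Fin k → 𝒳, ℝ)),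
      ∫ κ, orderedEval k f κ ∂(P : Measure (Profile 𝒳)) =
        ∫ x, f x ∂(m k : Measure (Fin k → 𝒳)) := by
  let := TopologicalSpace.metrizableSpaceMetric (Profile 𝒳)
  -- The law of the step profile of a sample from `μ_{n+1}`; the shift keeps the number of cells
  -- positive.
  let Q : ℕ → ProbabilityMeasure (Profile 𝒳) := fun n ↦ (m n.succPNat).map
    (f := fun x ↦ stepProfile (n := n + 1) x) continuous_stepProfile.measurable.aemeasurable
  -- Compactness of the space of probability measures gives a limit along a free ultrafilter, with
  -- no subsequence to extract.
  let U : Ultrafilter ℕ := Filter.hyperfilter ℕ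
  refine ⟨(U.map Q).lim, fun k f ↦ ?_⟩
  have hlim : Filter.Tendsto Q U (𝓝 (U.map Q).lim) := (U.map Q).le_nhds_lim
  have h1 : Filter.Tendsto (fun n ↦ ∫ κ, orderedEval k f κ ∂(Q n : Measure (Profile 𝒳))) U
      (𝓝 (∫ κ, orderedEval k f κ ∂((U.map Q).lim : Measure (Profile 𝒳)))) :=
    ((ProbabilityMeasure.continuous_integral_continuousMap (orderedEval k f)).tendsto _).comp hlim
  refine tendsto_nhds_unique h1 (Filter.Tendsto.mono_left ?_ Nat.hyperfilter_le_atTop)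
  let r : ℕ → ℝ := fun n ↦ (n.descFactorial k : ℝ) / (n : ℝ) ^ (k : ℕ)
  have hr : Filter.Tendsto (fun n ↦ r (n + 1)) Filter.atTop (𝓝 1) :=
    (tendsto_descFactorial_div_pow k).comp (Filter.tendsto_add_atTop_nat 1)
  let J := ∫ x, f x ∂(m k : Measure (Fin k → 𝒳))
  have hbound : ∀ᶠ n in Filter.atTop,
      |∫ κ, orderedEval k f κ ∂(Q n : Measure (Profile 𝒳)) - r (n + 1) * J| ≤
        ‖f‖ * (1 - r (n + 1)) := by
    filter_upwards [Filter.eventually_ge_atTop (k : ℕ)] with n hn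
    have hkn : k ≤ n.succPNat := by
      rw [← PNat.coe_le_coe]
      simpa using hn.trans n.le_succ
    let μ : Measure (Fin (n + 1) → 𝒳) := (m n.succPNat : Measure (Fin n.succPNat → 𝒳))
    have hμ : IsProbabilityMeasure μ := inferInstanceAs
      (IsProbabilityMeasure (m n.succPNat : Measure (Fin n.succPNat → 𝒳)))
    have hJ : J = ((n + 1).choose k : ℝ)⁻¹ * ∑ i : Fin k ↪o Fin (n + 1), ∫ x, f (x ∘ i) ∂μ := by
      simp only [J]
      rw [hm k n.succPNat hkn]
      exact integral_thin μ f
    have hfi : ∀ i : Fin k ↪o Fin (n + 1), Integrable (fun x ↦ f (x ∘ i)) μ := fun i ↦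
      ContinuousMap.integrable_of_compactSpace ⟨fun x : Fin (n + 1) → 𝒳 ↦ f (x ∘ i), by fun_prop⟩ μ
    -- Thinning invariance enters here, through `hJ`: the average over `k`-subsets has mean `J`, and
    -- `r` corrects the normalization from `choose` to `k! / (n + 1) ^ k`.
    have hrJ : r (n + 1) * J = ∫ x, (k : ℕ)! * (((n + 1 : ℕ) : ℝ) ^ (k : ℕ))⁻¹ *
        ∑ i : Fin k ↪o Fin (n + 1), f (x ∘ i) ∂μ := by
      have hc : ((n + 1).choose k : ℝ) ≠ 0 := by
        exact_mod_cast (Nat.choose_pos (hn.trans n.le_succ)).ne'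
      rw [integral_const_mul, integral_finsetSum _ fun i _ ↦ hfi i, hJ, ← mul_assoc]
      congr 1
      simp only [r]
      rw [Nat.descFactorial_eq_factorial_mul_choose]
      push_cast
      field_simp
    have hQ : ∫ κ, orderedEval k f κ ∂(Q n : Measure (Profile 𝒳)) =
        ∫ x, orderedEval k f (stepProfile (n := n + 1) x) ∂μ :=
      integral_map continuous_stepProfile.measurable.aemeasurable
        (orderedEval k f).continuous.aestronglyMeasurable
    have hoi : Integrable (fun x ↦ orderedEval k f (stepProfile (n := n + 1) x)) μ :=
      ContinuousMap.integrable_of_compactSpace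
        ((orderedEval k f).comp ⟨stepProfile, continuous_stepProfile⟩) μ
    rw [hQ, hrJ, ← integral_sub hoi ((integrable_finsetSum _ fun i _ ↦ hfi i).const_mul _)]
    have := norm_integral_le_of_norm_le_const (μ := μ)
      (f := fun x ↦ orderedEval k f (stepProfile (n := n + 1) x) -
        (k : ℕ)! * (((n + 1 : ℕ) : ℝ) ^ (k : ℕ))⁻¹ * ∑ i : Fin k ↪o Fin (n + 1), f (x ∘ i)) (Filter.Eventually.of_forall fun x ↦
      abs_integral_orderedLaw_stepProfile_sub_le (n := n + 1) x f)
    simpa [r] using this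
  have h0 : Filter.Tendsto (fun n ↦ ‖f‖ * (1 - r (n + 1))) Filter.atTop (𝓝 0) := by
    simpa using (hr.const_sub 1).const_mul ‖f‖
  have hd := squeeze_zero_norm' (hbound.mono fun n hn ↦ by rwa [Real.norm_eq_abs]) h0
  have := hd.add (hr.mul_const J)
  simpa using this

/-! ### Mixtures of ordered laws as thinning-invariant arrays. -/

instance : PolishSpace (Profile 𝒳) := by
  let := TopologicalSpace.metrizableSpaceMetric (Profile 𝒳)
  infer_instance

/-- The ordered laws, as a kernel from profiles. -/
def orderedKernel (𝒳 : Type*) [MetricSpace 𝒳] [CompactSpace 𝒳] [MeasurableSpace 𝒳] [BorelSpace 𝒳]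
    (n : ℕ) : Kernel (Profile 𝒳) (Fin n → 𝒳) where
  toFun κ := orderedLaw κ n
  measurable' := by
    let g : Profile 𝒳 → ProbabilityMeasure (Fin n → 𝒳) := fun κ ↦ ⟨orderedLaw κ n, inferInstance⟩
    have hg : Continuous g :=
      ProbabilityMeasure.continuous_iff_forall_continuousMap_continuous_integral.2
        (continuous_integral_orderedLaw n)
    exact measurable_subtype_coe.comp hg.measurable

instance (n : ℕ) : IsMarkovKernel (orderedKernel 𝒳 n) :=
  ⟨fun κ ↦ inferInstanceAs (IsProbabilityMeasure (orderedLaw κ n))⟩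

lemma orderedMixture_eq (P : ProbabilityMeasure (Profile 𝒳)) (n : ℕ) :
    orderedMixture P n = (P : Measure (Profile 𝒳)).bind (orderedKernel 𝒳 n) := rfl

instance (P : ProbabilityMeasure (Profile 𝒳)) (n : ℕ) : IsProbabilityMeasure (orderedMixture P n) := by
  rw [orderedMixture_eq]
  infer_instance

lemma integral_orderedMixture (P : ProbabilityMeasure (Profile 𝒳)) (n : ℕ) (f : C(Fin n → 𝒳, ℝ)) :
    ∫ x, f x ∂(orderedMixture P n) = ∫ κ, orderedEval n f κ ∂(P : Measure (Profile 𝒳)) := by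
  rw [orderedMixture_eq, Measure.integral_bind_kernel _ _ (f.integrable_of_compactSpace _)]
  rfl

lemma thin_orderedMixture (P : ProbabilityMeasure (Profile 𝒳)) {k n : ℕ} (hkn : k ≤ n) :
    thin k n (orderedMixture P n) = orderedMixture P k := by
  have : IsFiniteMeasure (thin k n (orderedMixture P n)) := by
    have : (n.choose k : ℝ≥0∞)⁻¹ ≠ ∞ := by simp [(Nat.choose_pos hkn).ne']
    exact Measure.smul_finite _ this
  refine Measure.ext_of_forall_integral_continuousMap_eq fun f ↦ ?_
  let fi : (Fin k ↪o Fin n) → C(Fin n → 𝒳, ℝ) := fun i ↦ ⟨fun x ↦ f (x ∘ i), by fun_prop⟩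
  have h1 : ∀ i : Fin k ↪o Fin n, ∫ x, f (x ∘ i) ∂(orderedMixture P n) =
      ∫ κ, orderedEval n (fi i) κ ∂(P : Measure (Profile 𝒳)) := fun i ↦
    integral_orderedMixture P n (fi i)
  rw [integral_thin, integral_orderedMixture]
  simp_rw [h1]
  rw [← integral_finsetSum _ fun i _ ↦ (orderedEval n (fi i)).integrable_of_compactSpace _,
    ← integral_const_mul]
  refine integral_congr_ae (Filter.Eventually.of_forall fun κ ↦ ?_)
  simp only [orderedEval_apply]
  rw [← thin_orderedLaw κ hkn, integral_thin]
  rfl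

/-- The thinning-invariant array of a mixing measure. -/
def mixtureArray (P : ProbabilityMeasure (Profile 𝒳)) : TriangularArray 𝒳 :=
  fun n ↦ ⟨orderedMixture P n, inferInstance⟩

lemma coe_mixtureArray (P : ProbabilityMeasure (Profile 𝒳)) (n : ℕ+) :
    (mixtureArray P n : Measure (Fin n → 𝒳)) = orderedMixture P n := rfl

lemma thinningInvariant_mixtureArray (P : ProbabilityMeasure (Profile 𝒳)) :
    ThinningInvariant (mixtureArray P) :=
  fun _ _ hkn ↦ (thin_orderedMixture P hkn).symm

lemma mixing_measure_unique {P P' : ProbabilityMeasure (Profile 𝒳)}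
    (h : ∀ n : ℕ+, orderedMixture P n = orderedMixture P' n) : P = P' := by
  refine Subtype.ext (eq_of_forall_integral_orderedEval_eq
    (P := (P : Measure (Profile 𝒳))) (P' := (P' : Measure (Profile 𝒳))) fun n f ↦ ?_)
  rw [← integral_orderedMixture, ← integral_orderedMixture, h]

lemma ThinningInvariant.exists_eq_orderedMixture {m : TriangularArray 𝒳} (hm : ThinningInvariant m) :
    ∃ P : ProbabilityMeasure (Profile 𝒳),
      ∀ n : ℕ+, (m n : Measure (Fin n → 𝒳)) = orderedMixture P n := by
  obtain ⟨P, hP⟩ := exists_integral_orderedEval_eq m hm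
  refine ⟨P, fun n ↦ Measure.ext_of_forall_integral_continuousMap_eq fun f ↦ ?_⟩
  rw [← hP, integral_orderedMixture]

/-! ### The simplex of invariant arrays, its extreme points and representing measures. -/

/-- The functional on `∏ C(𝒳^n)` given by a mixing measure. -/
def mixtureFunctional (P : ProbabilityMeasure (Profile 𝒳)) : ArraySpace 𝒳 :=
  fun n f ↦ ∫ κ, orderedEval n f κ ∂(P : Measure (Profile 𝒳))

lemma toFunctional_eq_mixtureFunctional {m : TriangularArray 𝒳} {P : ProbabilityMeasure (Profile 𝒳)}
    (h : ∀ n : ℕ+, (m n : Measure (Fin n → 𝒳)) = orderedMixture P n) :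
    m.toFunctional = mixtureFunctional P := by
  ext n f
  simp only [TriangularArray.toFunctional, mixtureFunctional, h, integral_orderedMixture]

variable (𝒳) in
lemma thinningInvariantSet_eq_range : thinningInvariantSet 𝒳 = range mixtureFunctional := by
  ext x
  constructor
  · rintro ⟨m, hm, rfl⟩
    obtain ⟨P, hP⟩ := ThinningInvariant.exists_eq_orderedMixture hm
    exact ⟨P, (toFunctional_eq_mixtureFunctional hP).symm⟩
  · rintro ⟨P, rfl⟩
    exact ⟨mixtureArray P, thinningInvariant_mixtureArray P,
      toFunctional_eq_mixtureFunctional (coe_mixtureArray P)⟩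

lemma continuous_mixtureFunctional : Continuous (mixtureFunctional (𝒳 := 𝒳)) :=
  continuous_pi fun _ ↦ continuous_pi fun _ ↦
    ProbabilityMeasure.continuous_integral_continuousMap _

lemma mixtureFunctional_injective : Function.Injective (mixtureFunctional (𝒳 := 𝒳)) :=
  fun P P' h ↦ Subtype.ext (eq_of_forall_integral_orderedEval_eq
    (P := (P : Measure (Profile 𝒳))) (P' := (P' : Measure (Profile 𝒳)))
      fun n f ↦ congrFun (congrFun h n) f)

lemma exists_mixtureFunctional_eq_add (P P' : ProbabilityMeasure (Profile 𝒳)) {a b : ℝ} (ha : 0 ≤ a)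
    (hb : 0 ≤ b) (hab : a + b = 1) : ∃ R : ProbabilityMeasure (Profile 𝒳),
      mixtureFunctional R = a • mixtureFunctional P + b • mixtureFunctional P' ∧
      (R : Measure (Profile 𝒳)) = ENNReal.ofReal a • (P : Measure (Profile 𝒳)) +
        ENNReal.ofReal b • (P' : Measure (Profile 𝒳)) := by
  have hR : IsProbabilityMeasure (ENNReal.ofReal a • (P : Measure (Profile 𝒳)) +
      ENNReal.ofReal b • (P' : Measure (Profile 𝒳))) := ⟨by
    simp [← ENNReal.ofReal_add ha hb, hab]⟩
  refine ⟨⟨_, hR⟩, ?_, rfl⟩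
  ext n f
  simp only [mixtureFunctional, ProbabilityMeasure.coe_mk, Pi.add_apply, Pi.smul_apply, smul_eq_mul]
  rw [integral_add_measure, integral_smul_measure, integral_smul_measure,
    ENNReal.toReal_ofReal ha, ENNReal.toReal_ofReal hb, smul_eq_mul, smul_eq_mul]
  · exact ((orderedEval n f).integrable_of_compactSpace _).smul_measure ENNReal.ofReal_ne_top
  · exact ((orderedEval n f).integrable_of_compactSpace _).smul_measure ENNReal.ofReal_ne_top

variable (𝒳) in
lemma convex_thinningInvariantSet : Convex ℝ (thinningInvariantSet 𝒳) := by
  rw [thinningInvariantSet_eq_range]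
  rintro _ ⟨P, rfl⟩ _ ⟨P', rfl⟩ a b ha hb hab
  obtain ⟨R, hR, -⟩ := exists_mixtureFunctional_eq_add P P' ha hb hab
  exact ⟨R, hR⟩

/-- The functional on `∏ C(𝒳^n)` given by the ordered laws of a single profile. -/
def profileFunctional (κ : Profile 𝒳) : ArraySpace 𝒳 := fun n f ↦ orderedEval n f κ

lemma mixtureFunctional_diracProba (κ : Profile 𝒳) :
    mixtureFunctional (diracProba κ) = profileFunctional κ := by
  ext n f
  exact integral_dirac _ _

lemma continuous_profileFunctional : Continuous (profileFunctional (𝒳 := 𝒳)) :=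
  continuous_pi fun n ↦ continuous_pi fun f ↦ (orderedEval n f).continuous

lemma profileFunctional_injective : Function.Injective (profileFunctional (𝒳 := 𝒳)) := by
  intro κ κ' h
  exact Profile.ext_of_orderedLaw fun n ↦
    Measure.ext_of_forall_integral_continuousMap_eq fun f ↦ congrFun (congrFun h n) f

/-- By injectivity, a convex decomposition lifts to one of the Dirac mass at `κ`; a component of
positive weight is then carried by `κ`. -/
lemma profileFunctional_mem_extremePoints (κ : Profile 𝒳) :
    profileFunctional κ ∈ (thinningInvariantSet 𝒳).extremePoints ℝ := by
  rw [mem_extremePoints_iff_left, thinningInvariantSet_eq_range]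
  refine ⟨⟨_, mixtureFunctional_diracProba κ⟩, ?_⟩
  rintro _ ⟨P, rfl⟩ _ ⟨P', rfl⟩ ⟨a, b, ha, hb, hab, h⟩
  obtain ⟨R, hR, hR'⟩ := exists_mixtureFunctional_eq_add P P' ha.le hb.le hab
  have hRκ : R = diracProba κ := mixtureFunctional_injective (by
    rw [hR, h, mixtureFunctional_diracProba])
  have hP : ∀ᵐ κ' ∂(P : Measure (Profile 𝒳)), κ' = κ := by
    have h1 : ∀ᵐ κ' ∂(R : Measure (Profile 𝒳)), κ' = κ := by
      rw [hRκ]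
      exact (ae_dirac_iff (measurableSet_eq (a := κ))).2 rfl
    rw [hR', ae_add_measure_iff] at h1
    exact (Measure.ae_ennreal_smul_measure_iff (by simpa using ha)).1 h1.1
  ext n f
  have : (fun κ' ↦ orderedEval n f κ') =ᵐ[(P : Measure (Profile 𝒳))] fun _ ↦ orderedEval n f κ := by
    filter_upwards [hP] with κ' hκ'
    rw [hκ']
  simp [mixtureFunctional, profileFunctional, integral_congr_ae this]

/-- If `0 < P A < 1`, then `P` is a proper mixture of its conditionings on `A` and `Aᶜ`; extremality
forces `P` to equal the first, so `P A = 1`, a contradiction. A zero–one measure on a Polish space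
is a Dirac mass. -/
lemma exists_profileFunctional_eq_of_mem_extremePoints {x : ArraySpace 𝒳}
    (hx : x ∈ (thinningInvariantSet 𝒳).extremePoints ℝ) : ∃ κ, profileFunctional κ = x := by
  rw [mem_extremePoints_iff_left, thinningInvariantSet_eq_range] at hx
  obtain ⟨⟨P, rfl⟩, hext⟩ := hx
  have hP : IsZeroOneMeasure (P : Measure (Profile 𝒳)) := by
    refine ⟨fun A hA ↦ ?_⟩
    by_contra! hcon
    have hA0 : (P : Measure (Profile 𝒳)) A ≠ 0 := hcon.1
    have hAc0 : (P : Measure (Profile 𝒳)) Aᶜ ≠ 0 := fun h ↦ hcon.2 ((prob_compl_eq_zero_iff hA).1 h)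
    let P₁ : ProbabilityMeasure (Profile 𝒳) := ⟨_, cond_isProbabilityMeasure hA0⟩
    let P₂ : ProbabilityMeasure (Profile 𝒳) := ⟨_, cond_isProbabilityMeasure hAc0⟩
    have hP1 : mixtureFunctional P₁ = mixtureFunctional P := by
      refine hext _ ⟨P₁, rfl⟩ _ ⟨P₂, rfl⟩ ⟨(P : Measure (Profile 𝒳)).real A,
        (P : Measure (Profile 𝒳)).real Aᶜ, ?_, ?_, probReal_add_probReal_compl hA, ?_⟩
      · exact ENNReal.toReal_pos hA0 (measure_ne_top _ _)
      · exact ENNReal.toReal_pos hAc0 (measure_ne_top _ _)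
      · ext n f
        have h1 : ∀ B, (P : Measure (Profile 𝒳)) B ≠ 0 → (P : Measure (Profile 𝒳)).real B *
            ∫ κ, orderedEval n f κ ∂((P : Measure (Profile 𝒳))[|B]) =
              ∫ κ in B, orderedEval n f κ ∂(P : Measure (Profile 𝒳)) := by
          intro B hB
          have hB' : (P : Measure (Profile 𝒳)).real B ≠ 0 := by
            rwa [measureReal_ne_zero_iff]
          rw [ProbabilityTheory.cond, integral_smul_measure, ENNReal.toReal_inv, smul_eq_mul,
            ← Measure.real_def, mul_inv_cancel_left₀ hB']
        refine (congrArg₂ (· + ·) (h1 A hA0) (h1 Aᶜ hAc0)).trans ?_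
        exact integral_add_compl hA ((orderedEval n f).integrable_of_compactSpace _)
    have hP1' : P₁ = P := mixtureFunctional_injective hP1
    have h2 : (P₁ : Measure (Profile 𝒳)) A = 1 := cond_apply_self hA0 (measure_ne_top _ _)
    rw [hP1'] at h2
    exact hcon.2 h2
  obtain ⟨κ, hκ⟩ := IsZeroOneMeasure.exists_eq_dirac (μ := (P : Measure (Profile 𝒳)))
  refine ⟨κ, ?_⟩
  rw [← mixtureFunctional_diracProba]
  exact congrArg _ (Subtype.ext hκ.symm)

variable (𝒳) in
lemma extremePoints_thinningInvariantSet :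
    (thinningInvariantSet 𝒳).extremePoints ℝ = range profileFunctional := by
  ext x
  refine ⟨exists_profileFunctional_eq_of_mem_extremePoints, ?_⟩
  rintro ⟨κ, rfl⟩
  exact profileFunctional_mem_extremePoints κ

/-- Profiles parametrize the extreme points. -/
def profileEquiv (𝒳 : Type*) [MetricSpace 𝒳] [CompactSpace 𝒳] [MeasurableSpace 𝒳]
    [BorelSpace 𝒳] : Profile 𝒳 ≃ (thinningInvariantSet 𝒳).extremePoints ℝ :=
  Equiv.ofBijective (fun κ ↦ ⟨profileFunctional κ, profileFunctional_mem_extremePoints κ⟩)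
    ⟨fun _ _ h ↦ profileFunctional_injective (congrArg Subtype.val h), fun x ↦
      (exists_profileFunctional_eq_of_mem_extremePoints x.2).imp fun _ h ↦ Subtype.ext h⟩

lemma continuous_profileEquiv : Continuous (profileEquiv 𝒳) :=
  continuous_profileFunctional.subtype_mk profileFunctional_mem_extremePoints

/-- Profiles parametrize the extreme points homeomorphically. -/
def profileHomeomorph (𝒳 : Type*) [MetricSpace 𝒳] [CompactSpace 𝒳] [MeasurableSpace 𝒳]
    [BorelSpace 𝒳] : Profile 𝒳 ≃ₜ (thinningInvariantSet 𝒳).extremePoints ℝ :=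
  (continuous_profileEquiv (𝒳 := 𝒳)).homeoOfEquivCompactToT2

/-- Continuous linear functionals on `ArraySpace` are finite combinations of coordinates. -/
lemma ArraySpace.mem_span_coordinates (ℓ : ArraySpace 𝒳 →L[ℝ] ℝ) :
    (ℓ : ArraySpace 𝒳 →ₗ[ℝ] ℝ) ∈ Submodule.span ℝ (range
      (fun p : (n : ℕ+) × C(Fin n → 𝒳, ℝ) ↦
        (LinearMap.proj p.2).comp (LinearMap.proj (R := ℝ) p.1 : ArraySpace 𝒳 →ₗ[ℝ] _))) := by
  -- Lying in the span of the coordinates is the same as being continuous for the topology they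
  -- induce, which is the product topology.
  rw [LinearMap.mem_span_iff_continuous]
  convert! ℓ.continuous using 1
  simp only [Pi.topologicalSpace, induced_iInf, induced_compose, iInf_sigma]
  rfl

/-- A mixing measure represents its functional. -/
lemma integral_apply_profileFunctional (P : ProbabilityMeasure (Profile 𝒳))
    (ℓ : ArraySpace 𝒳 →L[ℝ] ℝ) :
    ∫ κ, ℓ (profileFunctional κ) ∂(P : Measure (Profile 𝒳)) = ℓ (mixtureFunctional P) := by
  suffices h : Integrable (fun κ ↦ (ℓ : ArraySpace 𝒳 →ₗ[ℝ] ℝ) (profileFunctional κ))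
      (P : Measure (Profile 𝒳)) ∧
      ∫ κ, (ℓ : ArraySpace 𝒳 →ₗ[ℝ] ℝ) (profileFunctional κ) ∂(P : Measure (Profile 𝒳)) =
        (ℓ : ArraySpace 𝒳 →ₗ[ℝ] ℝ) (mixtureFunctional P) from h.2
  refine Submodule.span_induction (p := fun (L : ArraySpace 𝒳 →ₗ[ℝ] ℝ) _ ↦
    Integrable (fun κ ↦ L (profileFunctional κ)) (P : Measure (Profile 𝒳)) ∧
      ∫ κ, L (profileFunctional κ) ∂(P : Measure (Profile 𝒳)) = L (mixtureFunctional P))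
    ?_ ?_ ?_ ?_ (ArraySpace.mem_span_coordinates ℓ)
  · rintro _ ⟨⟨n, f⟩, rfl⟩
    exact ⟨(orderedEval n f).integrable_of_compactSpace _, rfl⟩
  · simp
  · rintro L L' - - ⟨h1, h2⟩ ⟨h1', h2'⟩
    refine ⟨h1.add h1', ?_⟩
    simp only [LinearMap.add_apply]
    rw [integral_add h1 h1', h2, h2']
  · rintro c L - ⟨h1, h2⟩
    refine ⟨h1.const_mul c, ?_⟩
    simp only [LinearMap.smul_apply, smul_eq_mul]
    rw [integral_const_mul, h2]

variable (𝒳) in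
lemma isBauerSimplex_thinningInvariantSet : IsBauerSimplex (thinningInvariantSet 𝒳) where
  isCompact := by
    rw [thinningInvariantSet_eq_range]
    exact isCompact_range continuous_mixtureFunctional
  convex := convex_thinningInvariantSet 𝒳
  isClosed_extremePoints := by
    rw [extremePoints_thinningInvariantSet]
    exact (isCompact_range continuous_profileFunctional).isClosed
  existsUnique_representing := by
    intro x hx
    rw [thinningInvariantSet_eq_range] at hx
    obtain ⟨P, rfl⟩ := hx
    let : MeasurableSpace ((thinningInvariantSet 𝒳).extremePoints ℝ) := borel _
    have : BorelSpace ((thinningInvariantSet 𝒳).extremePoints ℝ) := ⟨rfl⟩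
    let ψ := profileHomeomorph 𝒳
    refine ⟨(P : Measure (Profile 𝒳)).map ψ, ⟨?_, ?_, fun ℓ ↦ ?_⟩, ?_⟩
    · exact Measure.isProbabilityMeasure_map ψ.continuous.measurable.aemeasurable
    · exact Measure.Regular.map ψ
    · rw [ψ.measurableEmbedding.integral_map]
      exact integral_apply_profileFunctional P ℓ
    · rintro Q ⟨hQ, -, hQℓ⟩
      -- A representing measure pulls back to a measure on profiles; tested on coordinate
      -- functionals alone, it has the same mixture as `P`.
      let P' : ProbabilityMeasure (Profile 𝒳) := ⟨Q.map ψ.symm,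
        Measure.isProbabilityMeasure_map ψ.symm.continuous.measurable.aemeasurable⟩
      have hQP' : Q = (P' : Measure (Profile 𝒳)).map ψ := by
        change Q = (Q.map ψ.symm).map ψ
        rw [Measure.map_map ψ.continuous.measurable ψ.symm.continuous.measurable]
        simp
      have hP' : P' = P := by
        refine mixtureFunctional_injective ?_
        ext n f
        have := hQℓ ((ContinuousLinearMap.proj f).comp
          (ContinuousLinearMap.proj (R := ℝ) n : ArraySpace 𝒳 →L[ℝ] _))
        rw [hQP', ψ.measurableEmbedding.integral_map] at this
        exact this
      rw [hQP', hP']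

end

theorem theorem1 (𝒳 : Type*) [MetricSpace 𝒳] [CompactSpace 𝒳] [MeasurableSpace 𝒳]
    [BorelSpace 𝒳] :
    -- `𝒦` is compact and metrizable
    CompactSpace (Profile 𝒳) ∧ TopologicalSpace.MetrizableSpace (Profile 𝒳) ∧
    -- every thinning-invariant array has a unique mixing measure
    (∀ m : TriangularArray 𝒳, ThinningInvariant m →
      ∃! P : ProbabilityMeasure (Profile 𝒳),
        ∀ n : ℕ+, (m n : Measure (Fin n → 𝒳)) = orderedMixture P n) ∧
    -- conversely, every mixing measure defines a thinning-invariant array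
    (∀ P : ProbabilityMeasure (Profile 𝒳), ∃ m : TriangularArray 𝒳, ThinningInvariant m ∧
      ∀ n : ℕ+, (m n : Measure (Fin n → 𝒳)) = orderedMixture P n) ∧
    -- the thinning-invariant arrays form a Bauer simplex
    IsBauerSimplex (thinningInvariantSet 𝒳) ∧
    -- every `μ ∈ 𝒦` defines an array, and these arrays are exactly the extreme points
    (∀ κ : Profile 𝒳, ∃ m : TriangularArray 𝒳,
      ∀ n : ℕ+, (m n : Measure (Fin n → 𝒳)) = orderedLaw κ n) ∧
    (thinningInvariantSet 𝒳).extremePoints ℝ =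
      TriangularArray.toFunctional '' {m : TriangularArray 𝒳 |
        ∃ κ : Profile 𝒳, ∀ n : ℕ+, (m n : Measure (Fin n → 𝒳)) = orderedLaw κ n} := by
  have hκ : ∀ κ : Profile 𝒳, ∃ m : TriangularArray 𝒳,
      ∀ n : ℕ+, (m n : Measure (Fin n → 𝒳)) = orderedLaw κ n :=
    fun κ ↦ ⟨fun n ↦ ⟨orderedLaw κ n, inferInstance⟩, fun n ↦ rfl⟩
  have hfun : ∀ (κ : Profile 𝒳) (m : TriangularArray 𝒳),
      (∀ n : ℕ+, (m n : Measure (Fin n → 𝒳)) = orderedLaw κ n) →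
        m.toFunctional = profileFunctional κ := by
    intro κ m h
    ext n f
    simp only [TriangularArray.toFunctional, h]
    rfl
  refine ⟨inferInstance, inferInstance, fun m hm ↦ ?_, fun P ↦
    ⟨mixtureArray P, thinningInvariant_mixtureArray P, coe_mixtureArray P⟩,
    isBauerSimplex_thinningInvariantSet 𝒳, hκ, ?_⟩
  · obtain ⟨P, hP⟩ := hm.exists_eq_orderedMixture
    exact ⟨P, hP, fun P' hP' ↦ mixing_measure_unique fun n ↦ by rw [← hP', hP]⟩
  · rw [extremePoints_thinningInvariantSet]
    ext x
    constructor
    · rintro ⟨κ, rfl⟩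
      obtain ⟨m, hm⟩ := hκ κ
      exact ⟨m, ⟨κ, hm⟩, hfun κ m hm⟩
    · rintro ⟨m, ⟨κ, hm⟩, rfl⟩
      exact ⟨κ, (hfun κ m hm).symm⟩
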